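/- For an integer $n\ge 5$, an integer $m\ge 1$ and a real $\alpha>1$, consider the $\alpha$-Pólya urn on the colours $0,1,\dots,n$ with initial tallies $(N_0(0),\dots,N_0(n))=(m,1,\dots,1)$, driven by i.i.d. random variables $U_1,U_2,\dots$ that are uniform on $[0,1]$: at step $j\ge 1$ colour $i$ is selected, and its tally is increased by one, if $$\frac{\sum_{i'<i}N_{j-1}(i')^\alpha}{\sum_{i'=0}^{n}N_{j-1}(i')^\alpha}<U_j\le\frac{\sum_{i'\le i}N_{j-1}(i')^\alpha}{\sum_{i'=0}^{n}N_{j-1}(i')^\alpha}.$$ For a (finite or infinite) initial stretch of the run consider the event that - colour $0$, and no other colour, is selected more than $2m-1$ times, and - at least $5$ colours are selected exactly $m-1$ times. Call $(\alpha,m,n)$ admissible if this event has probability $>\frac45$ for the whole infinite run. Then for every $\alpha>1$: 1. there is $m_0$ such that for every $m\ge m_0$ there is $n\ge 5$ with $(\alpha,m,n)$ admissible; 2. for all $m\ge 1$ and $n\ge 5$ with $(\alpha,m,n)$ admissible there is $M_0$, depending only on $\alpha,m,n$, such that for every $M\ge M_0$ the event above for the first $M$ selections, which is determined by $U_1,\dots,U_M$,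 has probability $>\frac45$. -/

import Mathlib

open MeasureTheory ProbabilityTheory
open scoped BigOperators

noncomputable section

/-- In an `α`-Pólya urn on the colours `0, …, n` with current tallies `x`, the number `t`
selects the colour `i`. The sums over `i' < i` and `i' ≤ i` cut `(0, 1]` into consecutive
intervals of lengths proportional to `(x i) ^ α`. -/
def UrnSelects {n : ℕ} (α : ℝ) (x : Fin (n + 1) → ℕ) (t : ℝ) (i : Fin (n + 1)) : Prop :=
  (∑ i' ∈ Finset.Iio i, (x i' : ℝ) ^ α) / (∑ i', (x i' : ℝ) ^ α) < t ∧
    t ≤ (∑ i' ∈ Finset.Iic i, (x i' : ℝ) ^ α) / (∑ i', (x i' : ℝ) ^ α)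

open Classical in
/-- The tallies after `j` selections of the `α`-Pólya urn on the colours `0, …, n` started from
`(m, 1, …, 1)` and driven by `u`. The sequence `u 0, u 1, …` plays the part of `U₁, U₂, …`,
so `u j` determines the selection made from the tallies after `j` selections. -/
def urnTally (α : ℝ) (m n : ℕ) (u : ℕ → ℝ) : ℕ → Fin (n + 1) → ℕ
  | 0 => fun i => if i = 0 then m else 1
  | j + 1 => fun i =>
      urnTally α m n u j i + if UrnSelects α (urnTally α m n u j) (u j) i then 1 else 0

/-- How many of the selections with (zero-based) index in `J` are of colour `i`, possibly `∞`. -/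
def urnCount (α : ℝ) (m n : ℕ) (u : ℕ → ℝ) (J : Set ℕ) (i : Fin (n + 1)) : ℕ∞ :=
  Set.encard {j | j ∈ J ∧ UrnSelects α (urnTally α m n u j) (u j) i}

/-- Among the selections with index in `J`, colour `0` and no other colour is selected more than
`2m - 1` times, and at least `5` colours are selected exactly `m - 1` times (used for `1 ≤ m`). -/
def UrnOutcome (α : ℝ) (m n : ℕ) (u : ℕ → ℝ) (J : Set ℕ) : Prop :=
  (∀ i : Fin (n + 1), ((2 * m - 1 : ℕ) : ℕ∞) < urnCount α m n u J i ↔ i = 0) ∧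
    5 ≤ Set.encard {i : Fin (n + 1) | urnCount α m n u J i = ((m - 1 : ℕ) : ℕ∞)}

/-- The law of a sequence of independent random variables uniform on `[0, 1]`. -/
def uniformSeqLaw : Measure (ℕ → ℝ) :=
  Measure.infinitePi fun _ : ℕ => (volume : Measure ℝ).restrict (Set.Icc 0 1)

/-- For the whole (infinite) run of the urn, the outcome above has probability `> 4/5`. -/
def UrnParameters (α : ℝ) (m n : ℕ) : Prop :=
  4 / 5 < uniformSeqLaw.real {u | UrnOutcome α m n u Set.univ}

end

/-! Let every colour evolve in continuous time as an independent pure birth process with rate `k ^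
α` at tally `k`; the order of the jumps is then that of the urn. As `α > 1`, each process explodes.
Colour `0`, with its head start `m`, explodes at a time with mean `μ = urnTail α m`, of order `m ^
(1 - α)`, and Chebyshev's inequality concentrates this time around `μ` as `m` grows. What the other
colours have reached by then decides the outcome. Each of them, started from `1`, sits exactly at
`m` with some small probability at least `q`, and has passed `2 m` with a probability that is
negligible against `q` (`exists_window`). With `n` about `40 / q` colours, at least about `40` are
expected at `m` and fewer than `1 / 100` beyond `2 m`.

The comparison in `exists_window` rests on `exists_hasGrowth`: reaching `m` within a time of order
`μ` requires the first, slow steps to be unusually short, so a fixed relative amount of extra time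
makes it exponentially more likely. Hence a colour that has reached `m` has most likely just done
so. To be beyond `2 m` it must have reached `m` much earlier or have crossed from `m` to `2 m + 1`
unusually fast, and both cost an exponential factor.

The embedding itself is never constructed. If the functions `φ k` solve the backward equation, then
the mean of `∏ φ (x i) (c + T)`, with `T` the time colour `0` needs from `x 0` to a high level `L`,
is harmonic for the discrete urn (`BackwardFamily.harmonic`). Its expectation after `M` selections
is thus its initial value, a one-dimensional integral. One choice of `φ` vanishes on colours that
went too far, which bounds the probability of no overshoot from below; another keeps the mean at
least `1 / 32` when fewer than five colours are at `m`, which bounds that probability from above.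
The constant `c = urnTail α L` replaces the time from `L` to explosion by its mean.

Finite stretches and the whole run are linked by the fact that, on the outcome, the counts of all
colours but `0` are eventually constant. -/

noncomputable section

/-! ### One step of the urn -/

section Selection

variable {n : ℕ} {α : ℝ} {x : Fin (n + 1) → ℕ} {t : ℝ}

lemma UrnSelects.unique {i j : Fin (n + 1)} (hi : UrnSelects α x t i) (hj : UrnSelects α x t j) :
    i = j := by
  have key : ∀ i j : Fin (n + 1), i < j → UrnSelects α x t i → UrnSelects α x t j → False := by
    intro i j hij hi hj
    have hS : (0 : ℝ) ≤ ∑ i', (x i' : ℝ) ^ α := Finset.sum_nonneg fun _ _ => by positivity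
    have h1 : (∑ i' ∈ Finset.Iic i, (x i' : ℝ) ^ α) ≤ ∑ i' ∈ Finset.Iio j, (x i' : ℝ) ^ α :=
      Finset.sum_le_sum_of_subset_of_nonneg
        (fun k hk => Finset.mem_Iio.2 (lt_of_le_of_lt (Finset.mem_Iic.1 hk) hij))
        fun _ _ _ => by positivity
    have h2 := div_le_div_of_nonneg_right h1 hS
    exact absurd (hi.2.trans h2) (not_le.2 hj.1)
  rcases lt_trichotomy i j with h | h | h
  · exact (key i j h hi hj).elim
  · exact h
  · exact (key j i h hj hi).elim

lemma urnTotal_pos (hx : ∀ i, 1 ≤ x i) : (0 : ℝ) < ∑ i', (x i' : ℝ) ^ α :=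
  Finset.sum_pos (fun i _ => Real.rpow_pos_of_pos (by exact_mod_cast hx i) α)
    Finset.univ_nonempty

lemma exists_urnSelects (hx : ∀ i, 1 ≤ x i) (ht : t ∈ Set.Ioc (0 : ℝ) 1) :
    ∃ i, UrnSelects α x t i := by
  classical
  have hS := urnTotal_pos (α := α) hx
  let s : Finset (Fin (n + 1)) := Finset.univ.filter fun i =>
    t ≤ (∑ i' ∈ Finset.Iic i, (x i' : ℝ) ^ α) / (∑ i', (x i' : ℝ) ^ α)
  have hs : s.Nonempty := by
    refine ⟨Fin.last n, Finset.mem_filter.2 ⟨Finset.mem_univ _, ?_⟩⟩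
    have : Finset.Iic (Fin.last n) = Finset.univ := by
      ext i; simp [Fin.le_last]
    rw [this, div_self hS.ne']
    exact ht.2
  refine ⟨s.min' hs, ?_, (Finset.mem_filter.1 (s.min'_mem hs)).2⟩
  by_contra hcon
  rw [not_lt] at hcon
  obtain h0 | ⟨k, hk⟩ := Fin.eq_zero_or_eq_succ (s.min' hs)
  · have : Finset.Iio (s.min' hs) = ∅ := by
      rw [h0]; ext i; simp
    rw [this] at hcon
    simp at hcon
    exact absurd ht.1 (not_lt.2 hcon)
  · have hI : Finset.Iio (s.min' hs) = Finset.Iic k.castSucc := by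
      rw [hk]; ext i
      simp [Fin.lt_def, Fin.le_def]
    rw [hI] at hcon
    have hmem : k.castSucc ∈ s := Finset.mem_filter.2 ⟨Finset.mem_univ _, hcon⟩
    have := s.min'_le _ hmem
    rw [hk] at this
    exact absurd this (not_le.2 (Fin.castSucc_lt_succ))

lemma setOf_urnSelects (i : Fin (n + 1)) :
    {t | UrnSelects α x t i} = Set.Ioc
      ((∑ i' ∈ Finset.Iio i, (x i' : ℝ) ^ α) / (∑ i', (x i' : ℝ) ^ α))
      ((∑ i' ∈ Finset.Iic i, (x i' : ℝ) ^ α) / (∑ i', (x i' : ℝ) ^ α)) := rfl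

lemma measurableSet_urnSelects (i : Fin (n + 1)) : MeasurableSet {t | UrnSelects α x t i} := by
  rw [setOf_urnSelects]; exact measurableSet_Ioc

lemma volume_urnSelects (hx : ∀ i, 1 ≤ x i) (i : Fin (n + 1)) :
    (volume.restrict (Set.Icc (0 : ℝ) 1)).real {t | UrnSelects α x t i} =
      (x i : ℝ) ^ α / ∑ i', (x i' : ℝ) ^ α := by
  have hS := urnTotal_pos (α := α) hx
  have hsplit : (∑ i' ∈ Finset.Iic i, (x i' : ℝ) ^ α) =
      (x i : ℝ) ^ α + ∑ i' ∈ Finset.Iio i, (x i' : ℝ) ^ α := by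
    rw [← Finset.Iio_insert, Finset.sum_insert (by simp)]
  have hsub : {t | UrnSelects α x t i} ⊆ Set.Icc (0 : ℝ) 1 := by
    rintro t ⟨h1, h2⟩
    refine ⟨le_trans (div_nonneg (Finset.sum_nonneg fun _ _ => by positivity) hS.le) h1.le,
      h2.trans ?_⟩
    rw [div_le_one hS]
    exact Finset.sum_le_sum_of_subset_of_nonneg (Finset.subset_univ _) fun _ _ _ => by positivity
  rw [measureReal_restrict_apply (measurableSet_urnSelects i), Set.inter_eq_left.2 hsub,
    setOf_urnSelects, Real.volume_real_Ioc_of_le]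
  · rw [hsplit]; ring
  · rw [hsplit]
    gcongr
    exact le_add_of_nonneg_left (by positivity)

open Classical in
/-- The tallies after the number `t` has made its selection from the tallies `x`. -/
def urnStep (α : ℝ) (x : Fin (n + 1) → ℕ) (t : ℝ) : Fin (n + 1) → ℕ :=
  fun i => x i + if UrnSelects α x t i then 1 else 0

lemma urnTally_succ (α : ℝ) (m n : ℕ) (u : ℕ → ℝ) (j : ℕ) :
    urnTally α m n u (j + 1) = urnStep α (urnTally α m n u j) (u j) := rfl

lemma urnStep_of_selects {i : Fin (n + 1)} (h : UrnSelects α x t i) :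
    urnStep α x t = x + Pi.single i 1 := by
  classical
  ext k
  simp only [urnStep, Pi.add_apply]
  by_cases hk : k = i
  · subst hk; simp [h]
  · have : ¬ UrnSelects α x t k := fun h' => hk (h'.unique h)
    simp [this, hk]

lemma measurable_urnStep : Measurable fun t => urnStep α x t := by
  classical
  refine measurable_pi_lambda _ fun i => ?_
  exact measurable_const.add
    (Measurable.ite (measurableSet_urnSelects i) measurable_const measurable_const)

lemma measurable_urnStep_prod :
    Measurable fun p : (Fin (n + 1) → ℕ) × ℝ => urnStep α p.1 p.2 :=
  measurable_from_prod_countable_right fun _ => measurable_urnStep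

instance : IsProbabilityMeasure ((volume : Measure ℝ).restrict (Set.Icc 0 1)) :=
  ⟨by simp⟩

instance : IsProbabilityMeasure uniformSeqLaw := by
  unfold uniformSeqLaw; infer_instance

lemma ae_mem_Ioc_unit : ∀ᵐ t ∂((volume : Measure ℝ).restrict (Set.Icc 0 1)),
    t ∈ Set.Ioc (0 : ℝ) 1 := by
  rw [← Measure.restrict_congr_set (Ioc_ae_eq_Icc (μ := (volume : Measure ℝ)))]
  exact ae_restrict_mem measurableSet_Ioc

/-- The interval lengths are the transition probabilities. The decomposition holds only almost
everywhere, because `t = 0` selects no colour. -/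
lemma integral_urnStep (hx : ∀ i, 1 ≤ x i) (h : (Fin (n + 1) → ℕ) → ℝ) :
    ∫ t, h (urnStep α x t) ∂((volume : Measure ℝ).restrict (Set.Icc 0 1)) =
      (∑ i, (x i : ℝ) ^ α * h (x + Pi.single i 1)) / ∑ i, (x i : ℝ) ^ α := by
  classical
  have h1 : (fun t => h (urnStep α x t)) =ᵐ[(volume : Measure ℝ).restrict (Set.Icc 0 1)]
      fun t => ∑ i, {t | UrnSelects α x t i}.indicator (fun _ => h (x + Pi.single i 1)) t := by
    filter_upwards [ae_mem_Ioc_unit] with t ht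
    obtain ⟨i, hi⟩ := exists_urnSelects (α := α) hx ht
    rw [urnStep_of_selects hi, Finset.sum_eq_single i]
    · rw [Set.indicator_of_mem]; exact hi
    · intro k _ hk
      rw [Set.indicator_of_notMem]
      exact fun h' => hk (UrnSelects.unique h' hi)
    · simp
  rw [integral_congr_ae h1, integral_finsetSum]
  · simp_rw [integral_indicator_const _ (measurableSet_urnSelects _), volume_urnSelects hx,
      smul_eq_mul]
    rw [Finset.sum_div]
    exact Finset.sum_congr rfl fun i _ => by ring
  · intro i _
    exact (integrable_const _).indicator (measurableSet_urnSelects i)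

end Selection

/-! ### The tallies as a Markov chain -/

section Tally

variable {α : ℝ} {m n : ℕ}

lemma urnTally_congr {u v : ℕ → ℝ} {j : ℕ} (h : ∀ k < j, u k = v k) :
    urnTally α m n u j = urnTally α m n v j := by
  induction j with
  | zero => rfl
  | succ j ih =>
    rw [urnTally_succ, urnTally_succ, ih fun k hk => h k (by omega), h j (by omega)]

lemma measurable_urnTally (j : ℕ) : Measurable fun u : ℕ → ℝ => urnTally α m n u j := by
  induction j with
  | zero => exact measurable_const
  | succ j ih => exact measurable_urnStep_prod.comp (ih.prodMk (measurable_pi_apply j))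

lemma urnTally_mono {u : ℕ → ℝ} (i : Fin (n + 1)) : Monotone fun j => urnTally α m n u j i :=
  monotone_nat_of_le_succ fun j => by simp [urnTally_succ, urnStep]

lemma urnTally_zero_le {u : ℕ → ℝ} (j : ℕ) (i : Fin (n + 1)) :
    urnTally α m n u 0 i ≤ urnTally α m n u j i := urnTally_mono i (Nat.zero_le j)

lemma one_le_urnTally (hm : 1 ≤ m) (u : ℕ → ℝ) (j : ℕ) (i : Fin (n + 1)) :
    1 ≤ urnTally α m n u j i := by
  refine le_trans ?_ (urnTally_zero_le j i)
  simp only [urnTally]; split_ifs <;> omega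

lemma urnTally_le (u : ℕ → ℝ) (j : ℕ) (i : Fin (n + 1)) :
    urnTally α m n u j i ≤ urnTally α m n u 0 i + j := by
  induction j with
  | zero => simp
  | succ j ih =>
    rw [urnTally_succ]; unfold urnStep
    split_ifs <;> omega

lemma sum_urnTally (hm : 1 ≤ m) {u : ℕ → ℝ} (hu : ∀ j, u j ∈ Set.Ioc (0 : ℝ) 1) (j : ℕ) :
    ∑ i, urnTally α m n u j i = m + n + j := by
  induction j with
  | zero => simp [urnTally, Fin.sum_univ_succ]
  | succ j ih =>
    obtain ⟨i, hi⟩ := exists_urnSelects (α := α) (one_le_urnTally (n := n) (α := α) hm u j) (hu j)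
    rw [urnTally_succ, urnStep_of_selects hi]
    simp only [Pi.add_apply, Finset.sum_add_distrib, ih]
    simp; omega

lemma ae_mem_Ioc_uniformSeqLaw : ∀ᵐ u ∂uniformSeqLaw, ∀ j, u j ∈ Set.Ioc (0 : ℝ) 1 := by
  rw [ae_all_iff]
  intro j
  have h := (measurePreserving_eval_infinitePi
    (fun _ : ℕ => (volume : Measure ℝ).restrict (Set.Icc 0 1)) j).quasiMeasurePreserving
  exact h.ae ae_mem_Ioc_unit

/-- The first `j` selections use only `u 0, …, u (j - 1)`; `φ` pads these coordinates by `0` to a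
whole sequence. -/
lemma indepFun_urnTally (j : ℕ) :
    IndepFun (fun u => urnTally α m n u j) (fun u => u j) uniformSeqLaw := by
  classical
  have h := iIndepFun_infinitePi (P := fun _ : ℕ => (volume : Measure ℝ).restrict (Set.Icc 0 1))
    (X := fun _ x => x) fun _ => measurable_id
  have h2 := h.indepFun_finset (Finset.range j) {j} (by simp) fun i => measurable_pi_apply i
  let φ : ((i : Finset.range j) → ℝ) → Fin (n + 1) → ℕ := fun v =>
    urnTally α m n (fun k => if hk : k ∈ Finset.range j then v ⟨k, hk⟩ else 0) j
  have hφ : Measurable φ := by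
    refine (measurable_urnTally j).comp (measurable_pi_lambda _ fun k => ?_)
    by_cases hk : k ∈ Finset.range j
    · simp only [hk, dite_true]; exact measurable_pi_apply _
    · simp only [hk, dite_false]; exact measurable_const
  let ψ : ((i : ({j} : Finset ℕ)) → ℝ) → ℝ := fun v => v ⟨j, by simp⟩
  have hψ : Measurable ψ := measurable_pi_apply _
  have h3 := h2.comp hφ hψ
  have e : (fun u : ℕ → ℝ => urnTally α m n u j) =
      φ ∘ (fun a (i : Finset.range j) => (fun i (ω : ℕ → ℝ) => ω i) i a) := by
    funext u
    refine urnTally_congr fun k hk => ?_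
    simp [hk]
  rw [e]
  exact h3

lemma integral_urnTally_succ (hm : 1 ≤ m) (h : (Fin (n + 1) → ℕ) → ℝ) (hb : ∀ x, |h x| ≤ 1)
    (j : ℕ) :
    ∫ u, h (urnTally α m n u (j + 1)) ∂uniformSeqLaw =
      ∫ u, (∑ i, (urnTally α m n u j i : ℝ) ^ α * h (urnTally α m n u j + Pi.single i 1)) /
        (∑ i, (urnTally α m n u j i : ℝ) ^ α) ∂uniformSeqLaw := by
  have hmap := (indepFun_urnTally (α := α) (m := m) (n := n) j).map_prod_eq_prod_map_map
    (measurable_urnTally j).aemeasurable (measurable_pi_apply j).aemeasurable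
  have hev : uniformSeqLaw.map (fun u => u j) = (volume : Measure ℝ).restrict (Set.Icc 0 1) :=
    (measurePreserving_eval_infinitePi
      (fun _ : ℕ => (volume : Measure ℝ).restrict (Set.Icc 0 1)) j).map_eq
  rw [hev] at hmap
  have hmh : Measurable fun p : (Fin (n + 1) → ℕ) × ℝ => h (urnStep α p.1 p.2) :=
    (measurable_of_countable h).comp measurable_urnStep_prod
  have : IsProbabilityMeasure (uniformSeqLaw.map fun u => urnTally α m n u j) :=
    Measure.isProbabilityMeasure_map (measurable_urnTally j).aemeasurable
  calc ∫ u, h (urnTally α m n u (j + 1)) ∂uniformSeqLaw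
      = ∫ p, h (urnStep α p.1 p.2) ∂(uniformSeqLaw.map fun u => (urnTally α m n u j, u j)) := by
        rw [integral_map ((measurable_urnTally j).prodMk (measurable_pi_apply j)).aemeasurable
          hmh.aestronglyMeasurable]
        rfl
    _ = ∫ x, ∫ t, h (urnStep α x t) ∂((volume : Measure ℝ).restrict (Set.Icc 0 1))
          ∂(uniformSeqLaw.map fun u => urnTally α m n u j) := by
        rw [hmap, integral_prod]
        exact Integrable.of_bound hmh.aestronglyMeasurable 1 (Filter.Eventually.of_forall
          fun p => by simpa using hb _)
    _ = ∫ u, ∫ t, h (urnStep α (urnTally α m n u j) t)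
          ∂((volume : Measure ℝ).restrict (Set.Icc 0 1)) ∂uniformSeqLaw := by
        rw [integral_map (measurable_urnTally j).aemeasurable
          (measurable_of_countable _).aestronglyMeasurable]
    _ = _ := by
        refine integral_congr_ae (Filter.Eventually.of_forall fun u => ?_)
        exact integral_urnStep (one_le_urnTally hm u j) h

/-- A bounded function that is harmonic for the urn while colour `0` has tally below `L`
has constant expectation as long as that tally cannot exceed `L`. -/
lemma integral_urnTally_of_harmonic (hm : 1 ≤ m) (h : (Fin (n + 1) → ℕ) → ℝ)
    (hb : ∀ x, |h x| ≤ 1) (L : ℕ)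
    (hh : ∀ x : Fin (n + 1) → ℕ, (∀ i, 1 ≤ x i) → x 0 < L →
      ∑ i, (x i : ℝ) ^ α * h (x + Pi.single i 1) = (∑ i, (x i : ℝ) ^ α) * h x)
    (M : ℕ) (hM : m + M ≤ L) :
    ∫ u, h (urnTally α m n u M) ∂uniformSeqLaw = h (fun i => if i = 0 then m else 1) := by
  induction M with
  | zero => simp [urnTally]
  | succ M ih =>
    rw [integral_urnTally_succ hm h hb, ← ih (by omega)]
    refine integral_congr_ae (Filter.Eventually.of_forall fun u => ?_)
    have h1 := one_le_urnTally (n := n) (α := α) hm u M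
    have h2 : urnTally α m n u M 0 < L := by
      have := urnTally_le (α := α) (m := m) u M (0 : Fin (n + 1))
      simp only [urnTally, if_true] at this
      omega
    simp only
    rw [hh _ h1 h2, mul_comm, mul_div_assoc, div_self (urnTotal_pos h1).ne', mul_one]

end Tally

/-! ### Selection counts, finite stretches against the whole run -/

section Counts

variable {α : ℝ} {m n : ℕ} {u : ℕ → ℝ}

lemma urnCount_Iio (M : ℕ) (i : Fin (n + 1)) :
    urnCount α m n u (Set.Iio M) i =
      ((urnTally α m n u M i - urnTally α m n u 0 i : ℕ) : ℕ∞) := by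
  induction M with
  | zero => simp [urnCount]
  | succ M ih =>
    have hle := urnTally_zero_le (α := α) (m := m) (u := u) M i
    unfold urnCount at ih ⊢
    rw [urnTally_succ]; unfold urnStep
    by_cases hs : UrnSelects α (urnTally α m n u M) (u M) i
    · have : {j | j ∈ Set.Iio (M + 1) ∧ UrnSelects α (urnTally α m n u j) (u j) i} =
          insert M {j | j ∈ Set.Iio M ∧ UrnSelects α (urnTally α m n u j) (u j) i} := by
        ext j
        simp only [Set.mem_ofPred_eq, Set.mem_Iio, Set.mem_insert_iff]
        constructor
        · rintro ⟨h1, h2⟩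
          rcases Nat.lt_succ_iff_lt_or_eq.1 h1 with h | h
          · exact Or.inr ⟨h, h2⟩
          · exact Or.inl h
        · rintro (h | ⟨h1, h2⟩)
          · subst h; exact ⟨by omega, hs⟩
          · exact ⟨by omega, h2⟩
      rw [this, Set.encard_insert_of_notMem (by simp), ih, if_pos hs]
      norm_cast
      omega
    · have : {j | j ∈ Set.Iio (M + 1) ∧ UrnSelects α (urnTally α m n u j) (u j) i} =
          {j | j ∈ Set.Iio M ∧ UrnSelects α (urnTally α m n u j) (u j) i} := by
        ext j
        simp only [Set.mem_ofPred_eq, Set.mem_Iio]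
        constructor
        · rintro ⟨h1, h2⟩
          refine ⟨?_, h2⟩
          rcases Nat.lt_succ_iff_lt_or_eq.1 h1 with h | h
          · exact h
          · subst h; exact (hs h2).elim
        · rintro ⟨h1, h2⟩
          exact ⟨by omega, h2⟩
      rw [this, ih, if_neg hs]; simp

lemma urnCount_Iio_le_univ (M : ℕ) (i : Fin (n + 1)) :
    urnCount α m n u (Set.Iio M) i ≤ urnCount α m n u Set.univ i :=
  Set.encard_le_encard fun _ hj => ⟨trivial, hj.2⟩

/-- A finite lower bound on the number of selections of a colour shows up in finite time. -/
lemma exists_lt_urnCount_Iio {c : ℕ} {i : Fin (n + 1)}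
    (h : (c : ℕ∞) < urnCount α m n u Set.univ i) :
    ∃ M, (c : ℕ∞) < urnCount α m n u (Set.Iio M) i := by
  have h1 : ((c + 1 : ℕ) : ℕ∞) ≤ urnCount α m n u Set.univ i := by
    push_cast; exact Order.add_one_le_of_lt h
  obtain ⟨t, ht, hc⟩ := Set.exists_subset_encard_eq h1
  have hfin : t.Finite := Set.finite_of_encard_eq_coe hc
  obtain ⟨b, hb⟩ := hfin.bddAbove
  refine ⟨b + 1, lt_of_lt_of_le (b := ((c + 1 : ℕ) : ℕ∞)) (by exact_mod_cast Nat.lt_succ_self c) ?_⟩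
  rw [← hc]
  exact Set.encard_le_encard fun j hj => ⟨Nat.lt_succ_of_le (hb hj), (ht hj).2⟩

/-- A colour selected only finitely often is eventually never selected again. -/
lemma eventually_urnCount_Iio_eq {i : Fin (n + 1)}
    (h : urnCount α m n u Set.univ i ≠ ⊤) :
    ∃ M₁, ∀ M ≥ M₁, urnCount α m n u (Set.Iio M) i = urnCount α m n u Set.univ i := by
  have hfin := Set.encard_ne_top_iff.1 h
  obtain ⟨b, hb⟩ := hfin.bddAbove
  refine ⟨b + 1, fun M hM => le_antisymm (urnCount_Iio_le_univ M i) ?_⟩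
  refine Set.encard_le_encard fun j hj => ⟨?_, hj.2⟩
  have := hb hj
  simp only [Set.mem_Iio]; omega

lemma eventually_urnCount_Iio_eq_of_forall {c : ℕ}
    (h : ∀ i : Fin (n + 1), i ≠ 0 → urnCount α m n u Set.univ i ≤ c) :
    ∃ M₁, ∀ M ≥ M₁, ∀ i : Fin (n + 1), i ≠ 0 →
      urnCount α m n u (Set.Iio M) i = urnCount α m n u Set.univ i := by
  have h1 : ∀ i : Fin (n + 1), ∃ M₁, ∀ M ≥ M₁, i ≠ 0 →
      urnCount α m n u (Set.Iio M) i = urnCount α m n u Set.univ i := by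
    intro i
    by_cases hi : i = 0
    · exact ⟨0, fun _ _ h => (h hi).elim⟩
    · obtain ⟨M₁, hM₁⟩ := eventually_urnCount_Iio_eq (ne_top_of_le_ne_top (by simp) (h i hi))
      exact ⟨M₁, fun M hM _ => hM₁ M hM⟩
  choose f hf using h1
  exact ⟨Finset.univ.sup f, fun M hM i hi =>
    hf i M ((Finset.le_sup (Finset.mem_univ i)).trans hM) hi⟩

/-- The counts of the colours `i ≠ 0` are finite, hence eventually constant, and colour `0` exceeds
its bound from some time on. -/
lemma UrnOutcome.eventually (h : UrnOutcome α m n u Set.univ) :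
    ∃ M₁, ∀ M ≥ M₁, UrnOutcome α m n u (Set.Iio M) := by
  obtain ⟨M₁, hM₁⟩ := eventually_urnCount_Iio_eq_of_forall (c := 2 * m - 1)
    fun i hi => not_lt.1 fun hc => hi ((h.1 i).1 hc)
  obtain ⟨M₂, hM₂⟩ := exists_lt_urnCount_Iio ((h.1 0).2 rfl)
  refine ⟨max M₁ M₂, fun M hM => ?_⟩
  have h0 : ((2 * m - 1 : ℕ) : ℕ∞) < urnCount α m n u (Set.Iio M) 0 :=
    hM₂.trans_le (Set.encard_le_encard fun j hj =>
      ⟨lt_of_lt_of_le hj.1 ((le_max_right _ _).trans hM), hj.2⟩)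
  have hM' : M₁ ≤ M := (le_max_left _ _).trans hM
  refine ⟨fun i => ?_, h.2.trans (Set.encard_le_encard fun i hi => ?_)⟩
  · by_cases hi : i = 0
    · subst hi; simpa using h0
    · rw [hM₁ M hM' i hi]; exact h.1 i
  · by_cases hi0 : i = 0
    · subst hi0
      have h3 := (h.1 0).2 rfl
      rw [Set.mem_ofPred_eq] at hi
      rw [hi] at h3
      have : 2 * m - 1 < m - 1 := by exact_mod_cast h3
      omega
    · rw [Set.mem_ofPred_eq, hM₁ M hM' i hi0]; exact hi

/-- A count above `2 m - 1` would persist and contradict a later outcome, so the colours `i ≠ 0`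
have bounded counts. Once these are constant, a single outcome carries over. -/
lemma UrnOutcome.of_frequently (h : ∀ M₁, ∃ M ≥ M₁, UrnOutcome α m n u (Set.Iio M)) :
    UrnOutcome α m n u Set.univ := by
  have hle : ∀ i : Fin (n + 1), i ≠ 0 →
      urnCount α m n u Set.univ i ≤ ((2 * m - 1 : ℕ) : ℕ∞) := by
    intro i hi
    by_contra hcon
    obtain ⟨M₁, hM₁⟩ := exists_lt_urnCount_Iio (not_le.1 hcon)
    obtain ⟨M, hM, ho⟩ := h M₁
    refine hi ((ho.1 i).1 (hM₁.trans_le (Set.encard_le_encard fun j hj =>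
      ⟨lt_of_lt_of_le hj.1 hM, hj.2⟩)))
  obtain ⟨M₁, hM₁⟩ := eventually_urnCount_Iio_eq_of_forall hle
  obtain ⟨M, hM, ho⟩ := h M₁
  refine ⟨fun i => ?_, ho.2.trans (Set.encard_le_encard fun i hi => ?_)⟩
  · by_cases hi : i = 0
    · subst hi
      simpa using ((ho.1 0).2 rfl).trans_le (urnCount_Iio_le_univ M 0)
    · rw [← hM₁ M hM i hi]; exact ho.1 i
  · by_cases hi0 : i = 0
    · subst hi0
      have h3 := (ho.1 0).2 rfl
      rw [Set.mem_ofPred_eq] at hi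
      rw [hi] at h3
      have : 2 * m - 1 < m - 1 := by exact_mod_cast h3
      omega
    · rw [Set.mem_ofPred_eq, ← hM₁ M hM i hi0]; exact hi

lemma measurableSet_urnOutcome (M : ℕ) :
    MeasurableSet {u | UrnOutcome α m n u (Set.Iio M)} := by
  have : {u : ℕ → ℝ | UrnOutcome α m n u (Set.Iio M)} =
      (fun u => urnTally α m n u M) ⁻¹' {x | (∀ i : Fin (n + 1), ((2 * m - 1 : ℕ) : ℕ∞) <
        ((x i - (if i = 0 then m else 1) : ℕ) : ℕ∞) ↔ i = 0) ∧
        5 ≤ Set.encard {i : Fin (n + 1) | ((x i - (if i = 0 then m else 1) : ℕ) : ℕ∞) =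
          ((m - 1 : ℕ) : ℕ∞)}} := by
    ext u
    simp only [Set.mem_ofPred_eq, Set.mem_preimage, UrnOutcome, urnCount_Iio, urnTally]
  rw [this]
  exact measurable_urnTally M (Set.to_countable _).measurableSet

end Counts

/-! ### Exponential waiting times -/

section Exponential

variable {r : ℝ}

lemma integral_expMeasure (hr : 0 < r) (g : ℝ → ℝ) :
    ∫ s, g s ∂(expMeasure r) = ∫ s in Set.Ioi 0, r * Real.exp (-(r * s)) * g s := by
  have h : expMeasure r = volume.withDensity (exponentialPDF r) := rfl
  have hm : Measurable (exponentialPDF r) := by unfold exponentialPDF; fun_prop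
  rw [h, integral_withDensity_eq_integral_toReal_smul hm
    (Filter.Eventually.of_forall fun _ => by simp [exponentialPDF]),
    ← integral_Ici_eq_integral_Ioi, ← integral_indicator measurableSet_Ici]
  congr 1
  ext s
  by_cases hs : 0 ≤ s
  · rw [exponentialPDF_of_nonneg hs, ENNReal.toReal_ofReal (by positivity),
      Set.indicator_of_mem (Set.mem_Ici.2 hs), smul_eq_mul]
  · rw [exponentialPDF_of_neg (not_le.1 hs), Set.indicator_of_notMem (by simpa using hs)]
    simp

lemma integrable_expMeasure_iff (hr : 0 < r) (g : ℝ → ℝ) :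
    Integrable g (expMeasure r) ↔
      IntegrableOn (fun s => r * Real.exp (-(r * s)) * g s) (Set.Ioi 0) := by
  have h : expMeasure r = volume.withDensity (exponentialPDF r) := rfl
  have hm : Measurable (exponentialPDF r) := by unfold exponentialPDF; fun_prop
  rw [h, integrable_withDensity_iff_integrable_smul' hm
    (Filter.Eventually.of_forall fun _ => by simp [exponentialPDF]),
    ← integrableOn_Ici_iff_integrableOn_Ioi, ← integrable_indicator_iff measurableSet_Ici]
  refine integrable_congr (Filter.Eventually.of_forall fun s => ?_)
  change (exponentialPDF r s).toReal • g s = _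
  by_cases hs : 0 ≤ s
  · rw [exponentialPDF_of_nonneg hs, ENNReal.toReal_ofReal (by positivity),
      Set.indicator_of_mem (Set.mem_Ici.2 hs), smul_eq_mul]
  · rw [exponentialPDF_of_neg (not_le.1 hs), Set.indicator_of_notMem (by simpa using hs)]
    simp

lemma ae_nonneg_expMeasure (r : ℝ) : ∀ᵐ s ∂(expMeasure r), 0 ≤ s := by
  have h : expMeasure r = volume.withDensity (exponentialPDF r) := rfl
  have hm : Measurable (exponentialPDF r) := by unfold exponentialPDF; fun_prop
  rw [h, ae_withDensity_iff hm]
  refine Filter.Eventually.of_forall fun s hs => ?_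
  by_contra hcon
  exact hs (exponentialPDF_of_neg (not_le.1 hcon))

lemma integrable_pow_expMeasure (hr : 0 < r) (p : ℕ) :
    Integrable (fun s : ℝ => s ^ p) (expMeasure r) := by
  rw [integrable_expMeasure_iff hr]
  have h := integrableOn_rpow_mul_exp_neg_mul_rpow (s := (p : ℝ)) (p := 1) (b := r)
    (lt_of_lt_of_le (by norm_num) (Nat.cast_nonneg p)) one_pos hr
  refine IntegrableOn.congr_fun (h.const_mul r) (fun s hs => ?_) measurableSet_Ioi
  simp only [Real.rpow_one, Real.rpow_natCast, neg_mul]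
  ring

lemma integral_id_expMeasure (hr : 0 < r) : ∫ s, s ∂(expMeasure r) = 1 / r := by
  rw [integral_expMeasure hr]
  have h := Real.integral_rpow_mul_exp_neg_mul_Ioi (a := 2) (by norm_num) hr
  have e : ∀ s : ℝ, r * Real.exp (-(r * s)) * s = r * (s ^ ((2 : ℝ) - 1) * Real.exp (-(r * s))) := by
    intro s; norm_num; ring
  simp_rw [e]
  rw [integral_const_mul, h, show (2 : ℝ) = (1 : ℕ) + 1 by norm_num, Real.Gamma_nat_eq_factorial]
  norm_num
  field_simp

lemma integral_sq_expMeasure (hr : 0 < r) : ∫ s, s ^ 2 ∂(expMeasure r) = 2 / r ^ 2 := by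
  rw [integral_expMeasure hr]
  have h := Real.integral_rpow_mul_exp_neg_mul_Ioi (a := 3) (by norm_num) hr
  have e : ∀ s : ℝ, r * Real.exp (-(r * s)) * s ^ 2 =
      r * (s ^ ((3 : ℝ) - 1) * Real.exp (-(r * s))) := by
    intro s; norm_num; ring
  simp_rw [e]
  rw [integral_const_mul, h, show (3 : ℝ) = (2 : ℕ) + 1 by norm_num, Real.Gamma_nat_eq_factorial]
  norm_num
  field_simp

end Exponential

/-! ### Passage times of a pure birth process -/

section PassageLaw

/-- The law of the time that a pure birth process with rates `r` takes from the size `k` to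
the size `k + d`, as a function of `d` and `k`. -/
def passageLaw (r : ℕ → ℝ) : ℕ → ℕ → Measure ℝ
  | 0, _ => Measure.dirac 0
  | d + 1, k => expMeasure (r k) ∗ passageLaw r d (k + 1)

variable {r : ℕ → ℝ}

lemma isProbabilityMeasure_passageLaw (hr : ∀ k, 0 < r k) (d k : ℕ) :
    IsProbabilityMeasure (passageLaw r d k) := by
  induction d generalizing k with
  | zero => unfold passageLaw; infer_instance
  | succ d ih =>
    have := ih (k + 1)
    have := isProbabilityMeasure_expMeasure (hr k)
    unfold passageLaw; infer_instance

lemma passageLaw_add (hr : ∀ k, 0 < r k) (d e k : ℕ) :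
    passageLaw r (d + e) k = passageLaw r d k ∗ passageLaw r e (k + d) := by
  have hp := isProbabilityMeasure_passageLaw hr
  induction d generalizing k with
  | zero =>
    have := hp e k
    simp [passageLaw]
  | succ d ih =>
    have := hp d (k + 1)
    have := hp e (k + (d + 1))
    rw [show d + 1 + e = (d + e) + 1 by ring, passageLaw, ih, passageLaw, Measure.conv_assoc,
      show k + 1 + d = k + (d + 1) by ring]

lemma ae_nonneg_passageLaw (hr : ∀ k, 0 < r k) (d k : ℕ) :
    ∀ᵐ t ∂(passageLaw r d k), 0 ≤ t := by
  have hp := isProbabilityMeasure_passageLaw hr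
  induction d generalizing k with
  | zero => simp [passageLaw]
  | succ d ih =>
    have := hp d (k + 1)
    have := isProbabilityMeasure_expMeasure (hr k)
    rw [passageLaw, Measure.conv, ae_map_iff (by fun_prop) measurableSet_Ici]
    have h1 := Measure.quasiMeasurePreserving_fst (μ := expMeasure (r k))
      (ν := passageLaw r d (k + 1)) |>.ae (ae_nonneg_expMeasure (r k))
    have h2 := Measure.quasiMeasurePreserving_snd (μ := expMeasure (r k))
      (ν := passageLaw r d (k + 1)) |>.ae (ih (k + 1))
    filter_upwards [h1, h2] with p hp1 hp2
    exact add_nonneg hp1 hp2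

/-- Means and variances of independent exponential times add up; the second moment is given as
variance plus squared mean. -/
lemma passageLaw_moments (hr : ∀ k, 0 < r k) (d k : ℕ) :
    Integrable (fun t : ℝ => t) (passageLaw r d k) ∧
    Integrable (fun t : ℝ => t ^ 2) (passageLaw r d k) ∧
    ∫ t, t ∂(passageLaw r d k) = ∑ j ∈ Finset.range d, 1 / r (k + j) ∧
    ∫ t, t ^ 2 ∂(passageLaw r d k) =
      ∑ j ∈ Finset.range d, (1 / r (k + j)) ^ 2 + (∑ j ∈ Finset.range d, 1 / r (k + j)) ^ 2 := by
  induction d generalizing k with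
  | zero =>
    have h (p : ℕ) : Integrable (fun t : ℝ => t ^ p) (Measure.dirac (0 : ℝ)) :=
      integrable_dirac (by simp)
    refine ⟨by simpa [passageLaw] using h 1, h 2, by simp [passageLaw], by simp [passageLaw]⟩
  | succ d ih =>
    obtain ⟨i1, i2, e1, e2⟩ := ih (k + 1)
    have := isProbabilityMeasure_passageLaw hr d (k + 1)
    have := isProbabilityMeasure_expMeasure (hr k)
    have j1 : Integrable (fun t : ℝ => t) (expMeasure (r k)) := by
      simpa using integrable_pow_expMeasure (hr k) 1
    have j2 := integrable_pow_expMeasure (hr k) 2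
    have a1 : Integrable (fun p : ℝ × ℝ => p.1)
      ((expMeasure (r k)).prod (passageLaw r d (k + 1))) := j1.comp_fst _
    have a2 : Integrable (fun p : ℝ × ℝ => p.2)
      ((expMeasure (r k)).prod (passageLaw r d (k + 1))) := i1.comp_snd _
    have b1 : Integrable (fun p : ℝ × ℝ => p.1 ^ 2)
      ((expMeasure (r k)).prod (passageLaw r d (k + 1))) := j2.comp_fst _
    have b2 : Integrable (fun p : ℝ × ℝ => p.2 ^ 2)
      ((expMeasure (r k)).prod (passageLaw r d (k + 1))) := i2.comp_snd _
    have b3 : Integrable (fun p : ℝ × ℝ => p.1 * p.2)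
      ((expMeasure (r k)).prod (passageLaw r d (k + 1))) := j1.mul_prod i1
    have b4 : Integrable (fun p : ℝ × ℝ => p.1 ^ 2 + 2 * (p.1 * p.2))
      ((expMeasure (r k)).prod (passageLaw r d (k + 1))) := b1.add (b3.const_mul 2)
    have s1 : (fun p : ℝ × ℝ => (p.1 + p.2) ^ 2) =
        fun p => p.1 ^ 2 + 2 * (p.1 * p.2) + p.2 ^ 2 := by ext p; ring
    have hs : ∀ f : ℕ → ℝ, ∑ j ∈ Finset.range (d + 1), f (k + j) =
        f k + ∑ j ∈ Finset.range d, f (k + 1 + j) := by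
      intro f
      rw [Finset.sum_range_succ']
      simp only [add_zero]
      rw [add_comm]
      congr 1
      exact Finset.sum_congr rfl fun j _ => by congr 1; ring
    rw [passageLaw, Measure.conv]
    have m1 : Measurable fun p : ℝ × ℝ => p.1 + p.2 := by fun_prop
    refine ⟨?_, ?_, ?_, ?_⟩
    · rw [integrable_map_measure (by fun_prop) m1.aemeasurable]
      exact a1.add a2
    · rw [integrable_map_measure (by fun_prop) m1.aemeasurable]
      change Integrable (fun p : ℝ × ℝ => (p.1 + p.2) ^ 2) _
      rw [s1]
      exact b4.add b2
    · rw [integral_map m1.aemeasurable (by fun_prop), integral_add a1 a2,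
        integral_fun_fst (fun x : ℝ => x), integral_fun_snd (fun x : ℝ => x), e1, integral_id_expMeasure (hr k), hs fun j => 1 / r j]
      simp
    · rw [integral_map m1.aemeasurable (by fun_prop), s1, integral_add b4 b2,
        integral_add b1 (b3.const_mul 2), integral_const_mul, integral_prod_mul (fun x : ℝ => x)
        (fun x : ℝ => x), integral_fun_fst (fun x : ℝ => x ^ 2),
        integral_fun_snd (fun x : ℝ => x ^ 2), e1, e2, integral_id_expMeasure (hr k),
        integral_sq_expMeasure (hr k), hs fun j => (1 / r j) ^ 2, hs fun j => 1 / r j]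
      simp only [probReal_univ, one_smul]
      ring

/-- Chebyshev's inequality for passage times. -/
lemma passageLaw_deviation (hr : ∀ k, 0 < r k) (d k : ℕ) {c : ℝ} (hc : 0 < c) :
    (passageLaw r d k).real {t | c ≤ |t - ∑ j ∈ Finset.range d, 1 / r (k + j)|} ≤
      (∑ j ∈ Finset.range d, (1 / r (k + j)) ^ 2) / c ^ 2 := by
  have := isProbabilityMeasure_passageLaw hr d k
  obtain ⟨i1, i2, e1, e2⟩ := passageLaw_moments hr d k
  set a := ∑ j ∈ Finset.range d, 1 / r (k + j) with ha
  have s1 : (fun t : ℝ => (t - a) ^ 2) = fun t => t ^ 2 - (2 * a) * t + a ^ 2 := by ext t; ring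
  have i3 : Integrable (fun t : ℝ => t ^ 2 - (2 * a) * t) (passageLaw r d k) :=
    i2.sub (i1.const_mul _)
  have hi : Integrable (fun t : ℝ => (t - a) ^ 2) (passageLaw r d k) := by
    rw [s1]; exact i3.add (integrable_const _)
  have h := mul_meas_ge_le_integral_of_nonneg (μ := passageLaw r d k)
    (Filter.Eventually.of_forall fun t => sq_nonneg (t - a)) hi (c ^ 2)
  rw [le_div_iff₀ (by positivity), mul_comm]
  refine le_trans ?_ (h.trans ?_)
  · refine mul_le_mul_of_nonneg_left (measureReal_mono fun t ht => ?_) (sq_nonneg c)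
    have := pow_le_pow_left₀ hc.le (Set.mem_ofPred_eq ▸ ht) 2
    simpa [sq_abs] using this
  · rw [s1, integral_add i3 (integrable_const _),
      integral_sub i2 (i1.const_mul _), integral_const_mul, e1, e2]
    simp only [integral_const, probReal_univ, one_smul]
    apply le_of_eq; ring

end PassageLaw

/-! ### Distribution functions of passage times -/

section Cdf

variable {r : ℕ → ℝ}

lemma measureReal_conv_Iic (μ ν : Measure ℝ) [IsProbabilityMeasure μ] [IsProbabilityMeasure ν]
    (t : ℝ) : (μ ∗ ν).real (Set.Iic t) = ∫ s, ν.real (Set.Iic (t - s)) ∂μ := by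
  rw [← integral_indicator_one measurableSet_Iic, integral_conv]
  · refine integral_congr_ae (Filter.Eventually.of_forall fun s => ?_)
    simp only
    rw [← integral_indicator_one measurableSet_Iic]
    congr 1
    ext y
    simp only [Set.indicator_apply, Set.mem_Iic]
    congr 1
    exact propext ⟨fun h => by linarith, fun h => by linarith⟩
  · exact (integrable_const _).indicator measurableSet_Iic

/-- The probability that a pure birth process with rates `r` gets from the size `k` to the size
`k + d` by the time `t`, as a function of `d`, `k` and `t`. -/
def passageCdf (r : ℕ → ℝ) (d k : ℕ) (t : ℝ) : ℝ := (passageLaw r d k).real (Set.Iic t)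

lemma passageCdf_nonneg (d k : ℕ) (t : ℝ) : 0 ≤ passageCdf r d k t := measureReal_nonneg

lemma passageCdf_le_one (hr : ∀ k, 0 < r k) (d k : ℕ) (t : ℝ) : passageCdf r d k t ≤ 1 := by
  have := isProbabilityMeasure_passageLaw hr d k
  exact measureReal_le_one

lemma passageCdf_mono (hr : ∀ k, 0 < r k) (d k : ℕ) : Monotone (passageCdf r d k) := by
  have := isProbabilityMeasure_passageLaw hr d k
  exact fun s t h => measureReal_mono (Set.Iic_subset_Iic.2 h)

lemma passageCdf_of_neg (hr : ∀ k, 0 < r k) (d k : ℕ) {t : ℝ} (ht : t < 0) :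
    passageCdf r d k t = 0 := by
  have := isProbabilityMeasure_passageLaw hr d k
  rw [passageCdf, measureReal_eq_zero_iff]
  refine measure_mono_null (fun s hs => ?_) (ae_nonneg_passageLaw hr d k)
  exact fun h : 0 ≤ s => absurd (h.trans (Set.mem_Iic.1 hs)) (not_le.2 ht)

lemma passageCdf_zero {k : ℕ} {t : ℝ} (ht : 0 ≤ t) : passageCdf r 0 k t = 1 := by
  simp [passageCdf, passageLaw, measureReal_def, ht]

lemma passageCdf_add (hr : ∀ k, 0 < r k) (d e k : ℕ) (t : ℝ) :
    passageCdf r (d + e) k t = ∫ s, passageCdf r e (k + d) (t - s) ∂(passageLaw r d k) := by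
  have := isProbabilityMeasure_passageLaw hr d k
  have := isProbabilityMeasure_passageLaw hr e (k + d)
  rw [passageCdf, passageLaw_add hr, measureReal_conv_Iic]
  rfl

lemma passageCdf_succ (hr : ∀ k, 0 < r k) (d k : ℕ) (t : ℝ) :
    passageCdf r (d + 1) k t =
      ∫ s in Set.Ioi 0, r k * Real.exp (-(r k * s)) * passageCdf r d (k + 1) (t - s) := by
  have := isProbabilityMeasure_expMeasure (hr k)
  have := isProbabilityMeasure_passageLaw hr d (k + 1)
  rw [passageCdf, passageLaw, measureReal_conv_Iic, integral_expMeasure (hr k)]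
  rfl

end Cdf

/-! ### The backward equation -/

section Reach

variable {r : ℕ → ℝ}

/-- A smooth extension of `passageCdf` to the whole line. -/
def reach (r : ℕ → ℝ) : ℕ → ℕ → ℝ → ℝ
  | 0, _, _ => 1
  | d + 1, k, t =>
    Real.exp (-(r k * t)) * ∫ u in (0 : ℝ)..t, r k * Real.exp (r k * u) * reach r d (k + 1) u

lemma reach_continuous (r : ℕ → ℝ) (d k : ℕ) : Continuous (reach r d k) := by
  induction d generalizing k with
  | zero => exact continuous_const
  | succ d ih =>
    have := ih (k + 1)
    have h : Continuous fun u => r k * Real.exp (r k * u) * reach r d (k + 1) u := by fun_prop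
    exact (by fun_prop : Continuous fun t => Real.exp (-(r k * t))).mul
      (intervalIntegral.continuous_primitive (fun a b => h.intervalIntegrable a b) 0)

lemma hasDerivAt_reach (r : ℕ → ℝ) (d k : ℕ) (t : ℝ) :
    HasDerivAt (reach r (d + 1) k) (r k * (reach r d (k + 1) t - reach r (d + 1) k t)) t := by
  have := reach_continuous r d (k + 1)
  have h : Continuous fun u => r k * Real.exp (r k * u) * reach r d (k + 1) u := by fun_prop
  have h1 : HasDerivAt (fun t => ∫ u in (0 : ℝ)..t, r k * Real.exp (r k * u) * reach r d (k + 1) u)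
      (r k * Real.exp (r k * t) * reach r d (k + 1) t) t :=
    intervalIntegral.integral_hasDerivAt_right (h.intervalIntegrable _ _)
      (h.stronglyMeasurableAtFilter _ _) h.continuousAt
  have h2 : HasDerivAt (fun t => Real.exp (-(r k * t))) (Real.exp (-(r k * t)) * -(r k)) t := by
    simpa using (((hasDerivAt_id t).const_mul (r k)).neg).exp
  have h3 := h2.mul h1
  refine h3.congr_deriv ?_
  have e : Real.exp (-(r k * t)) * (r k * Real.exp (r k * t) * reach r d (k + 1) t) =
      r k * reach r d (k + 1) t := by
    rw [show Real.exp (-(r k * t)) * (r k * Real.exp (r k * t) * reach r d (k + 1) t) =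
      (Real.exp (-(r k * t)) * Real.exp (r k * t)) * (r k * reach r d (k + 1) t) by ring,
      ← Real.exp_add]
    simp
  rw [e, reach]
  ring

/-- The substitution `u = t - s` turns the convolution into the integral defining `reach`. Two
functions are kept because `passageCdf` vanishes for negative times and need not be differentiable
at `0`, whereas `reach` satisfies its equation everywhere. -/
lemma reach_eq_passageCdf (hr : ∀ k, 0 < r k) (d k : ℕ) {t : ℝ} (ht : 0 ≤ t) :
    reach r d k t = passageCdf r d k t := by
  induction d generalizing k t with
  | zero => rw [passageCdf_zero ht]; rfl
  | succ d ih =>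
    rw [passageCdf_succ hr, reach]
    have e1 : ∫ s in Set.Ioi 0, r k * Real.exp (-(r k * s)) * passageCdf r d (k + 1) (t - s) =
        ∫ s in Set.Ioc 0 t, r k * Real.exp (-(r k * s)) * passageCdf r d (k + 1) (t - s) := by
      refine (setIntegral_eq_of_subset_of_forall_sdiff_eq_zero measurableSet_Ioi
        Set.Ioc_subset_Ioi_self fun s hs => ?_)
      rw [passageCdf_of_neg hr, mul_zero]
      by_contra hcon
      exact hs.2 ⟨hs.1, by linarith⟩
    rw [e1, ← intervalIntegral.integral_of_le ht, ← intervalIntegral.integral_const_mul]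
    have e2 := intervalIntegral.integral_comp_sub_left (a := 0) (b := t)
      (fun u => r k * Real.exp (-(r k * (t - u))) * passageCdf r d (k + 1) u) t
    simp only [sub_sub_cancel, sub_self, sub_zero] at e2
    rw [e2]
    refine intervalIntegral.integral_congr fun u hu => ?_
    rw [Set.uIcc_of_le ht] at hu
    rw [ih (k + 1) hu.1, show -(r k * (t - u)) = -(r k * t) + r k * u by ring, Real.exp_add]
    ring

lemma reach_nonneg (hr : ∀ k, 0 < r k) (d k : ℕ) {t : ℝ} (ht : 0 ≤ t) : 0 ≤ reach r d k t := by
  rw [reach_eq_passageCdf hr d k ht]; exact passageCdf_nonneg _ _ _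

lemma reach_le_one (hr : ∀ k, 0 < r k) (d k : ℕ) {t : ℝ} (ht : 0 ≤ t) : reach r d k t ≤ 1 := by
  rw [reach_eq_passageCdf hr d k ht]; exact passageCdf_le_one hr _ _ _

/-- The smooth extension to the whole line of the probability that a pure birth process with
rates `r` gets from the size `k` to the size `l` by the time `t`. -/
def reachFrom (r : ℕ → ℝ) (l k : ℕ) (t : ℝ) : ℝ := reach r (l - k) k t

/-- For `l ≤ k` the truncated difference makes `reachFrom` the constant `1`, so one equation serves
all `k`. -/
lemma hasDerivAt_reachFrom (r : ℕ → ℝ) (l k : ℕ) (t : ℝ) :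
    HasDerivAt (reachFrom r l k) (r k * (reachFrom r l (k + 1) t - reachFrom r l k t)) t := by
  unfold reachFrom
  rcases Nat.lt_or_ge k l with h | h
  · obtain ⟨d, rfl⟩ := Nat.exists_eq_add_of_lt h
    rw [show k + d + 1 - k = d + 1 by omega, show k + d + 1 - (k + 1) = d by omega]
    exact hasDerivAt_reach r d k t
  · rw [Nat.sub_eq_zero_of_le h, Nat.sub_eq_zero_of_le (by omega)]
    simpa [reach] using hasDerivAt_const t (1 : ℝ)

end Reach

/-! ### Passage times under a change of starting level -/

section Generator

variable {r : ℕ → ℝ}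

/-- Integration by parts against the exponential density. -/
lemma integral_shift_expMeasure {c : ℝ} (hc : 0 < c) {g g' : ℝ → ℝ} {t B : ℝ}
    (hg : ∀ s, HasDerivAt g (g' s) s) (hg' : Continuous g')
    (hb : ∀ s ≥ t, |g s| ≤ B) (hb' : ∀ s ≥ t, |g' s| ≤ B) :
    ∫ s, g (t + s) ∂(expMeasure c) = g t + c⁻¹ * ∫ s, g' (t + s) ∂(expMeasure c) := by
  have hgc : Continuous g := continuous_iff_continuousAt.2 fun s => (hg s).continuousAt
  have h1 : IntegrableOn (fun s => Real.exp (-(c * s))) (Set.Ioi 0) := by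
    simpa [neg_mul] using exp_neg_integrableOn_Ioi 0 hc
  have i1 : ∀ f : ℝ → ℝ, Continuous f → (∀ s ≥ t, |f s| ≤ B) →
      IntegrableOn (fun s => Real.exp (-(c * s)) * f (t + s)) (Set.Ioi 0) := by
    intro f hf hfb
    refine Integrable.mul_bdd (c := B) h1 (by fun_prop) ?_
    refine (ae_restrict_mem measurableSet_Ioi).mono fun s hs => ?_
    exact hfb _ (by linarith [Set.mem_Ioi.1 hs])
  have d : ∀ s, HasDerivAt (fun s => -(Real.exp (-(c * s)) * g (t + s)))
      (c * (Real.exp (-(c * s)) * g (t + s)) - Real.exp (-(c * s)) * g' (t + s)) s := by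
    intro s
    have h2 : HasDerivAt (fun s => Real.exp (-(c * s))) (Real.exp (-(c * s)) * -c) s := by
      simpa using (((hasDerivAt_id s).const_mul c).neg).exp
    have h3 : HasDerivAt (fun s => g (t + s)) (g' (t + s)) s := (hg (t + s)).comp_const_add t s
    exact (h2.mul h3).neg.congr_deriv (by ring)
  have hlim : Filter.Tendsto (fun s => -(Real.exp (-(c * s)) * g (t + s))) Filter.atTop
      (nhds 0) := by
    have h4 : Filter.Tendsto (fun s => B * Real.exp (-(c * s))) Filter.atTop (nhds 0) := by
      have : Filter.Tendsto (fun s => Real.exp (-(c * s))) Filter.atTop (nhds 0) :=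
        Real.tendsto_exp_neg_atTop_nhds_zero.comp (Filter.tendsto_id.const_mul_atTop hc)
      simpa using this.const_mul B
    refine squeeze_zero_norm' ?_ h4
    filter_upwards [Filter.eventually_ge_atTop 0] with s hs
    rw [norm_neg, norm_mul, Real.norm_of_nonneg (Real.exp_pos _).le, mul_comm]
    exact mul_le_mul_of_nonneg_right (hb _ (by linarith)) (Real.exp_pos _).le
  have key := integral_Ioi_of_hasDerivAt_of_tendsto (a := 0) (d 0).continuousAt.continuousWithinAt
    (fun s _ => d s) (((i1 g hgc hb).const_mul c).sub (i1 g' hg' hb')) hlim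
  rw [integral_sub ((i1 g hgc hb).const_mul c) (i1 g' hg' hb'), integral_const_mul] at key
  simp only [mul_zero, neg_zero, Real.exp_zero, one_mul, add_zero, sub_neg_eq_add, zero_add] at key
  rw [integral_expMeasure hc, integral_expMeasure hc]
  simp_rw [mul_assoc]
  rw [integral_const_mul, integral_const_mul, inv_mul_cancel_left₀ hc.ne']
  linarith

/-- The passage from `k` is an independent exponential time followed by the passage from `k + 1`;
integrating out the former by parts leaves only `g'`. -/
lemma integral_passageLaw_succ (hr : ∀ k, 0 < r k) (d k : ℕ) {g g' : ℝ → ℝ} {B : ℝ}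
    (hg : ∀ s, HasDerivAt g (g' s) s) (hg' : Continuous g')
    (hb : ∀ s ≥ 0, |g s| ≤ B) (hb' : ∀ s ≥ 0, |g' s| ≤ B) :
    r k * (∫ t, g t ∂(passageLaw r d (k + 1)) - ∫ t, g t ∂(passageLaw r (d + 1) k)) =
      -∫ t, g' t ∂(passageLaw r (d + 1) k) := by
  have hgc : Continuous g := continuous_iff_continuousAt.2 fun s => (hg s).continuousAt
  have := isProbabilityMeasure_passageLaw hr d (k + 1)
  have := isProbabilityMeasure_passageLaw hr (d + 1) k
  have := isProbabilityMeasure_expMeasure (hr k)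
  have hi : ∀ e j, ∀ f : ℝ → ℝ, Continuous f → (∀ s ≥ 0, |f s| ≤ B) →
      Integrable f (passageLaw r e j) := by
    intro e j f hf hfb
    have := isProbabilityMeasure_passageLaw hr e j
    refine Integrable.of_bound hf.aestronglyMeasurable B ?_
    exact (ae_nonneg_passageLaw hr e j).mono fun s hs => hfb s hs
  have hconv : ∀ f : ℝ → ℝ, Continuous f → (∀ s ≥ 0, |f s| ≤ B) →
      ∫ t, f t ∂(passageLaw r (d + 1) k) =
        ∫ t, ∫ s, f (t + s) ∂(expMeasure (r k)) ∂(passageLaw r d (k + 1)) := by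
    intro f hf hfb
    have h := hi (d + 1) k f hf hfb
    rw [passageLaw, Measure.conv_comm] at h ⊢
    rw [integral_conv h]
  have hconvi : ∀ f : ℝ → ℝ, Continuous f → (∀ s ≥ 0, |f s| ≤ B) →
      Integrable (fun t => ∫ s, f (t + s) ∂(expMeasure (r k))) (passageLaw r d (k + 1)) := by
    intro f hf hfb
    have h := hi (d + 1) k f hf hfb
    rw [passageLaw, Measure.conv_comm, Measure.conv,
      integrable_map_measure hf.aestronglyMeasurable (by fun_prop)] at h
    exact h.integral_prod_left
  rw [hconv g hgc hb, hconv g' hg' hb']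
  have e : ∫ t, ∫ s, g (t + s) ∂(expMeasure (r k)) ∂(passageLaw r d (k + 1)) =
      ∫ t, (g t + (r k)⁻¹ * ∫ s, g' (t + s) ∂(expMeasure (r k))) ∂(passageLaw r d (k + 1)) := by
    refine integral_congr_ae ((ae_nonneg_passageLaw hr d (k + 1)).mono fun t ht => ?_)
    exact integral_shift_expMeasure (hr k) hg hg' (fun s hs => hb s (ht.trans hs))
      fun s hs => hb' s (ht.trans hs)
  rw [e, integral_add (hi _ _ g hgc hb) ((hconvi g' hg' hb').const_mul _), integral_const_mul]
  have := (hr k).ne'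
  field_simp
  ring

end Generator

/-- The rate at which a colour with tally `k` is selected in continuous time. -/
def urnRate (α : ℝ) (k : ℕ) : ℝ := ((max k 1 : ℕ) : ℝ) ^ α

/-- The `max` in `urnRate` matters only at `k = 0`, which is never a tally when `1 ≤ m`; it makes
all rates positive. -/
lemma urnRate_pos (α : ℝ) (k : ℕ) : 0 < urnRate α k :=
  Real.rpow_pos_of_pos (by exact_mod_cast Nat.lt_of_lt_of_le one_pos (le_max_right k 1)) α

lemma urnRate_of_one_le {k : ℕ} (α : ℝ) (hk : 1 ≤ k) : urnRate α k = (k : ℝ) ^ α := by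
  rw [urnRate, max_eq_left hk]

/-- A family of functions satisfying the backward equation of the pure birth process
with rates `r`, with values in `[0, 1]`. -/
structure BackwardFamily (r : ℕ → ℝ) (φ : ℕ → ℝ → ℝ) : Prop where
  hasDerivAt : ∀ k t, HasDerivAt (φ k) (r k * (φ (k + 1) t - φ k t)) t
  nonneg : ∀ k t, 0 ≤ t → 0 ≤ φ k t
  le_one : ∀ k t, 0 ≤ t → φ k t ≤ 1

/-! ### Harmonic functions of the urn -/

section Harmonic

variable {n : ℕ} {r : ℕ → ℝ} {φ : ℕ → ℝ → ℝ}

lemma BackwardFamily.continuous (h : BackwardFamily r φ) (k : ℕ) : Continuous (φ k) :=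
  continuous_iff_continuousAt.2 fun t => (h.hasDerivAt k t).continuousAt

/-- The expectation of `∏ φ (x i) T` over the colours `i ≠ 0`, where `T` is `c` plus the time
that colour `0` needs to get from the tally `x 0` to the tally `L`. -/
def spaceTimeMean (r : ℕ → ℝ) (φ : ℕ → ℝ → ℝ) (c : ℝ) (L : ℕ) (x : Fin (n + 1) → ℕ) : ℝ :=
  ∫ t, ∏ i : Fin n, φ (x i.succ) (c + t) ∂(passageLaw r (L - x 0) (x 0))

lemma BackwardFamily.prod_mem (h : BackwardFamily r φ) (y : Fin n → ℕ) {t : ℝ} (ht : 0 ≤ t)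
    (s : Finset (Fin n)) : ∏ i ∈ s, φ (y i) t ∈ Set.Icc (0 : ℝ) 1 :=
  ⟨Finset.prod_nonneg fun _ _ => h.nonneg _ _ ht,
    Finset.prod_le_one (fun _ _ => h.nonneg _ _ ht) fun _ _ => h.le_one _ _ ht⟩

lemma BackwardFamily.integrable_prod (hr : ∀ k, 0 < r k) (h : BackwardFamily r φ) {c : ℝ}
    (hc : 0 ≤ c) (y : Fin n → ℕ) (s : Finset (Fin n)) (d k : ℕ) :
    Integrable (fun t => ∏ i ∈ s, φ (y i) (c + t)) (passageLaw r d k) := by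
  have := isProbabilityMeasure_passageLaw hr d k
  have hcont := h.continuous
  refine Integrable.of_bound (Continuous.aestronglyMeasurable (by fun_prop)) 1 ?_
  refine (ae_nonneg_passageLaw hr d k).mono fun t ht => ?_
  have := h.prod_mem y (add_nonneg hc ht) s
  rw [Real.norm_of_nonneg this.1]
  exact this.2

lemma BackwardFamily.spaceTimeMean_mem (hr : ∀ k, 0 < r k) (h : BackwardFamily r φ) {c : ℝ}
    (hc : 0 ≤ c) (L : ℕ) (x : Fin (n + 1) → ℕ) :
    spaceTimeMean r φ c L x ∈ Set.Icc (0 : ℝ) 1 := by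
  have := isProbabilityMeasure_passageLaw hr (L - x 0) (x 0)
  have hae := (ae_nonneg_passageLaw hr (L - x 0) (x 0)).mono fun t ht =>
    h.prod_mem (fun i => x i.succ) (add_nonneg hc ht) Finset.univ
  refine ⟨integral_nonneg_of_ae (hae.mono fun t ht => ht.1), ?_⟩
  have h1 := integral_mono_ae (h.integrable_prod hr hc (fun i => x i.succ) Finset.univ _ _)
    (integrable_const (1 : ℝ)) (hae.mono fun t ht => ht.2)
  simpa [spaceTimeMean] using h1

lemma prod_add_single (f : ℕ → ℝ) (x : Fin (n + 1) → ℕ) (i : Fin n) :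
    ∏ j : Fin n, f ((x + Pi.single i.succ 1 : Fin (n + 1) → ℕ) j.succ) =
      (∏ j ∈ Finset.univ.erase i, f (x j.succ)) * f (x i.succ + 1) := by
  rw [← Finset.prod_erase_mul _ _ (Finset.mem_univ i)]
  congr 1
  · refine Finset.prod_congr rfl fun j hj => ?_
    have : j.succ ≠ i.succ := fun h => (Finset.ne_of_mem_erase hj) (Fin.succ_injective _ h)
    simp [this]
  · simp

/-- By the backward equation and the product rule, selections of the colours `i ≠ 0` contribute the
mean of the time derivative of the product. By `integral_passageLaw_succ`, selections of colour `0`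
contribute its negative. -/
lemma BackwardFamily.harmonic (hr : ∀ k, 0 < r k) (h : BackwardFamily r φ) {c : ℝ} (hc : 0 ≤ c)
    {L : ℕ} {x : Fin (n + 1) → ℕ} (hx : x 0 < L) :
    ∑ i, r (x i) * spaceTimeMean r φ c L (x + Pi.single i 1) =
      (∑ i, r (x i)) * spaceTimeMean r φ c L x := by
  obtain ⟨d, hd⟩ := Nat.exists_eq_add_of_lt hx
  have hcont := h.continuous
  have hd1 : L - x 0 = d + 1 := by omega
  have hd2 : L - (x 0 + 1) = d := by omega
  let g : ℝ → ℝ := fun t => ∏ i : Fin n, φ (x i.succ) (c + t)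
  let w : Fin n → ℝ → ℝ := fun i t =>
    (∏ j ∈ Finset.univ.erase i, φ (x j.succ) (c + t)) *
      (r (x i.succ) * (φ (x i.succ + 1) (c + t) - φ (x i.succ) (c + t)))
  have hw : ∀ i t, w i t = r (x i.succ) *
      (∏ j : Fin n, φ ((x + Pi.single i.succ 1 : Fin (n + 1) → ℕ) j.succ) (c + t) - g t) := by
    intro i t
    simp only [w, g]
    rw [prod_add_single (fun k => φ k (c + t)), ← Finset.prod_erase_mul _ _ (Finset.mem_univ i)]
    ring
  have hg : ∀ t, HasDerivAt g (∑ i, w i t) t := by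
    intro t
    have h1 := HasDerivAt.fun_finsetProd (u := Finset.univ) (f := fun (i : Fin n) t =>
      φ (x i.succ) (c + t)) (f' := fun i =>
      r (x i.succ) * (φ (x i.succ + 1) (c + t) - φ (x i.succ) (c + t))) (x := t)
      fun i _ => (h.hasDerivAt (x i.succ) (c + t)).comp_const_add c t
    simpa [w, g] using h1
  have hgc : Continuous fun t => ∑ i, w i t := by simp only [w]; fun_prop
  have hB : 0 ≤ ∑ i : Fin n, r (x i.succ) := Finset.sum_nonneg fun i _ => (hr _).le
  -- One bound has to serve both functions: `1` is enough for `g`, the sum of the rates for its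
  -- derivative.
  have key := integral_passageLaw_succ hr d (x 0) (B := 1 + ∑ i : Fin n, r (x i.succ)) hg hgc
    (fun t ht => by
      have := h.prod_mem (fun i => x i.succ) (add_nonneg hc ht) Finset.univ
      rw [abs_of_nonneg this.1]
      linarith [this.2])
    (fun t ht => by
      refine (Finset.abs_sum_le_sum_abs _ _).trans ?_
      refine le_trans (Finset.sum_le_sum fun i _ => ?_) (le_add_of_nonneg_left zero_le_one)
      rw [hw, abs_mul, abs_of_pos (hr _)]
      have h1 := h.prod_mem (fun i => x i.succ) (add_nonneg hc ht) Finset.univ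
      have h2 := h.prod_mem (fun j => (x + Pi.single i.succ 1 : Fin (n + 1) → ℕ) j.succ)
        (add_nonneg hc ht) Finset.univ
      refine mul_le_of_le_one_right (hr _).le ?_
      rw [abs_le]
      constructor <;> simp only [g] <;> linarith [h1.1, h1.2, h2.1, h2.2])
  have hs0 : spaceTimeMean r φ c L x = ∫ t, g t ∂(passageLaw r (d + 1) (x 0)) := by
    rw [spaceTimeMean, hd1]
  have hs1 : spaceTimeMean r φ c L (x + Pi.single 0 1) =
      ∫ t, g t ∂(passageLaw r d (x 0 + 1)) := by
    rw [spaceTimeMean]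
    simp only [Pi.add_apply, Pi.single_eq_same, hd2]
    simp [g]
  have hs2 : ∀ i : Fin n, spaceTimeMean r φ c L (x + Pi.single i.succ 1) =
      ∫ t, ∏ j : Fin n, φ ((x + Pi.single i.succ 1 : Fin (n + 1) → ℕ) j.succ) (c + t)
        ∂(passageLaw r (d + 1) (x 0)) := by
    intro i
    rw [spaceTimeMean]
    have : (x + Pi.single i.succ 1 : Fin (n + 1) → ℕ) 0 = x 0 := by simp
    rw [this, hd1]
  have hi := fun y => h.integrable_prod hr hc (n := n) y Finset.univ (d + 1) (x 0)
  have hint : ∫ t, ∑ i, w i t ∂(passageLaw r (d + 1) (x 0)) =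
      ∑ i : Fin n, r (x i.succ) * (spaceTimeMean r φ c L (x + Pi.single i.succ 1) -
        spaceTimeMean r φ c L x) := by
    simp_rw [hw]
    rw [integral_finsetSum]
    · refine Finset.sum_congr rfl fun i _ => ?_
      rw [integral_const_mul, integral_sub (hi _) (hi fun i => x i.succ), ← hs0, ← hs2]
    · exact fun i _ => ((hi _).sub (hi fun i => x i.succ)).const_mul _
  rw [hint, ← hs0, ← hs1] at key
  rw [Fin.sum_univ_succ, Fin.sum_univ_succ, add_mul, Finset.sum_mul]
  simp_rw [mul_sub] at key
  rw [Finset.sum_sub_distrib] at key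
  linarith

lemma integral_spaceTimeMean {α : ℝ} {m : ℕ} (hm : 1 ≤ m) (h : BackwardFamily (urnRate α) φ)
    {c : ℝ} (hc : 0 ≤ c) {L M : ℕ} (hM : m + M ≤ L) :
    ∫ u, spaceTimeMean (urnRate α) φ c L (urnTally α m n u M) ∂uniformSeqLaw =
      ∫ t, φ 1 (c + t) ^ n ∂(passageLaw (urnRate α) (L - m) m) := by
  rw [integral_urnTally_of_harmonic hm _ (fun x => ?_) L (fun x hx hL => ?_) M hM]
  · simp [spaceTimeMean]
  · have := h.spaceTimeMean_mem (urnRate_pos α) hc L x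
    rw [abs_of_nonneg this.1]; exact this.2
  · have := h.harmonic (urnRate_pos α) hc hL
    simpa only [urnRate_of_one_le α (hx _)] using this

end Harmonic

/-! ### The two families used: not yet reached, and half the occupation -/

section Families

variable {r : ℕ → ℝ}

lemma passageCdf_add_le (hr : ∀ k, 0 < r k) (d e k : ℕ) (t : ℝ) :
    passageCdf r (d + e) k t ≤ passageCdf r d k t := by
  have := isProbabilityMeasure_passageLaw hr d k
  rw [passageCdf_add hr]
  conv_rhs => rw [passageCdf, ← integral_indicator_one measurableSet_Iic]
  refine integral_mono_of_nonneg (Filter.Eventually.of_forall fun s => passageCdf_nonneg _ _ _)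
    ((integrable_const _).indicator measurableSet_Iic) (Filter.Eventually.of_forall fun s => ?_)
  by_cases hs : s ≤ t
  · simpa [Set.indicator_of_mem (Set.mem_Iic.2 hs)] using passageCdf_le_one hr _ _ _
  · simp only
    rw [passageCdf_of_neg hr _ _ (by linarith)]
    exact Set.indicator_nonneg (fun _ _ => zero_le_one) _

lemma passageLaw_one (hr : ∀ k, 0 < r k) (k : ℕ) : passageLaw r 1 k = expMeasure (r k) := by
  have := isProbabilityMeasure_expMeasure (hr k)
  simp [passageLaw]

lemma passageCdf_one_le (hr : ∀ k, 0 < r k) (k : ℕ) {t : ℝ} (ht : 0 ≤ t) :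
    passageCdf r 1 k t ≤ r k * t := by
  have := isProbabilityMeasure_expMeasure (hr k)
  rw [passageCdf, passageLaw_one hr, ← cdf_eq_real, cdf_expMeasure_eq (hr k), if_pos ht]
  linarith [Real.add_one_le_exp (-(r k * t))]

lemma reachFrom_nonneg (hr : ∀ k, 0 < r k) (l k : ℕ) {t : ℝ} (ht : 0 ≤ t) :
    0 ≤ reachFrom r l k t := reach_nonneg hr _ _ ht

lemma reachFrom_le_one (hr : ∀ k, 0 < r k) (l k : ℕ) {t : ℝ} (ht : 0 ≤ t) :
    reachFrom r l k t ≤ 1 := reach_le_one hr _ _ ht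

lemma reachFrom_of_le {l k : ℕ} (h : l ≤ k) (t : ℝ) : reachFrom r l k t = 1 := by
  rw [reachFrom, Nat.sub_eq_zero_of_le h]; rfl

lemma reachFrom_le_of_lt (hr : ∀ k, 0 < r k) {l k : ℕ} (h : k < l) {t : ℝ} (ht : 0 ≤ t) :
    reachFrom r l k t ≤ r k * t := by
  obtain ⟨d, rfl⟩ := Nat.exists_eq_add_of_lt h
  rw [reachFrom, reach_eq_passageCdf hr _ _ ht, show k + d + 1 - k = 1 + d by omega]
  exact (passageCdf_add_le hr _ _ _ _).trans (passageCdf_one_le hr k ht)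

lemma reachFrom_succ_le (hr : ∀ k, 0 < r k) (l k : ℕ) {t : ℝ} (ht : 0 ≤ t) :
    reachFrom r (l + 1) k t ≤ reachFrom r l k t := by
  rcases Nat.lt_or_ge l k with h | h
  · rw [reachFrom_of_le h, reachFrom_of_le h.le]
  · obtain ⟨d, rfl⟩ := Nat.exists_eq_add_of_le h
    rw [reachFrom, reachFrom, reach_eq_passageCdf hr _ _ ht, reach_eq_passageCdf hr _ _ ht,
      show k + d + 1 - k = d + 1 by omega, show k + d - k = d by omega]
    exact passageCdf_add_le hr _ _ _ _

lemma backwardFamily_notReached (hr : ∀ k, 0 < r k) (l : ℕ) :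
    BackwardFamily r fun k t => 1 - reachFrom r l k t where
  hasDerivAt k t := ((hasDerivAt_reachFrom r l k t).const_sub 1).congr_deriv (by ring)
  nonneg k t ht := sub_nonneg.2 (reachFrom_le_one hr l k ht)
  le_one k t ht := by linarith [reachFrom_nonneg hr l k ht]

/-- Half the probability that the process is at `l` at time `t`, subtracted from `1`. -/
lemma backwardFamily_occupation (hr : ∀ k, 0 < r k) (l : ℕ) :
    BackwardFamily r fun k t => 1 - (reachFrom r l k t - reachFrom r (l + 1) k t) / 2 where
  hasDerivAt k t := ((((hasDerivAt_reachFrom r l k t).sub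
    (hasDerivAt_reachFrom r (l + 1) k t)).div_const 2).const_sub 1).congr_deriv (by ring)
  nonneg k t ht := by
    linarith [reachFrom_le_one hr l k ht, reachFrom_nonneg hr (l + 1) k ht]
  le_one k t ht := by linarith [reachFrom_succ_le hr l k ht]

lemma one_sub_sum_le_prod_one_sub {ι : Type*} (s : Finset ι) (a : ι → ℝ)
    (h0 : ∀ i ∈ s, 0 ≤ a i) (h1 : ∀ i ∈ s, a i ≤ 1) :
    1 - ∑ i ∈ s, a i ≤ ∏ i ∈ s, (1 - a i) := by
  classical
  induction s using Finset.induction_on with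
  | empty => simp
  | insert i s hi ih =>
    rw [Finset.sum_insert hi, Finset.prod_insert hi]
    have h2 := ih (fun j hj => h0 j (Finset.mem_insert_of_mem hj))
      fun j hj => h1 j (Finset.mem_insert_of_mem hj)
    have h3 := h0 i (Finset.mem_insert_self i s)
    have h4 := h1 i (Finset.mem_insert_self i s)
    have h5 : 0 ≤ ∑ j ∈ s, a j := Finset.sum_nonneg fun j hj => h0 j (Finset.mem_insert_of_mem hj)
    nlinarith

/-- Halving the occupation probability keeps every factor at least `1 / 2`, so the at most four
colours at `l` cost at most `1 / 16`. A colour below `l` must leave its level to get there, and one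
above `l` never returns; the union bound handles these. -/
lemma occupation_prod_ge (hr : ∀ k, 0 < r k) (hmono : Monotone r) {n l : ℕ} (y : Fin n → ℕ)
    (hy : (Finset.univ.filter fun i => y i = l).card < 5) {t : ℝ} (ht : 0 ≤ t) :
    1 / 16 * (1 - n * r l * t / 2) ≤
      ∏ i, (1 - (reachFrom r l (y i) t - reachFrom r (l + 1) (y i) t) / 2) := by
  set a : Fin n → ℝ := fun i => (reachFrom r l (y i) t - reachFrom r (l + 1) (y i) t) / 2 with ha
  have ha0 : ∀ i, 0 ≤ a i := fun i => by
    have := reachFrom_succ_le hr l (y i) ht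
    simp only [ha]; linarith
  have ha1 : ∀ i, a i ≤ 1 / 2 := fun i => by
    have h1 := reachFrom_le_one hr l (y i) ht
    have h2 := reachFrom_nonneg hr (l + 1) (y i) ht
    simp only [ha]; linarith
  have hle : ∀ i, y i ≠ l → a i ≤ r l * t / 2 := by
    intro i hi
    have h0 : 0 ≤ r l * t := mul_nonneg (hr l).le ht
    rcases lt_or_gt_of_ne hi with h | h
    · have h1 := reachFrom_le_of_lt hr h ht
      have h2 := reachFrom_nonneg hr (l + 1) (y i) ht
      have h3 := mul_le_mul_of_nonneg_right (hmono h.le) ht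
      simp only [ha]; linarith
    · simp only [ha, reachFrom_of_le h.le, reachFrom_of_le (Nat.succ_le_of_lt h)]; linarith
  rw [← Finset.prod_filter_mul_prod_filter_not Finset.univ fun i => y i = l]
  set Z := Finset.univ.filter fun i => y i = l
  set W := Finset.univ.filter fun i => ¬ y i = l
  have h1 : (1 : ℝ) / 16 ≤ ∏ i ∈ Z, (1 - a i) := by
    calc (1 : ℝ) / 16 = (1 / 2) ^ 4 := by norm_num
      _ ≤ (1 / 2) ^ Z.card := pow_le_pow_of_le_one (by norm_num) (by norm_num) (by omega)
      _ = ∏ i ∈ Z, (1 / 2 : ℝ) := by simp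
      _ ≤ _ := Finset.prod_le_prod (fun _ _ => by norm_num) fun i _ => by linarith [ha1 i]
  have h2 : 1 - n * r l * t / 2 ≤ ∏ i ∈ W, (1 - a i) := by
    refine le_trans ?_ (one_sub_sum_le_prod_one_sub W a (fun i _ => ha0 i)
      fun i _ => by linarith [ha1 i])
    have h3 : ∑ i ∈ W, a i ≤ ∑ i ∈ W, r l * t / 2 :=
      Finset.sum_le_sum fun i hi => hle i (Finset.mem_filter.1 hi).2
    have h4 : (W.card : ℝ) ≤ n := by
      have := W.card_le_univ
      rw [Fintype.card_fin] at this
      exact_mod_cast this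
    rw [Finset.sum_const, nsmul_eq_mul] at h3
    have h0 : 0 ≤ r l * t / 2 := by have := mul_nonneg (hr l).le ht; linarith
    nlinarith
  have h5 : 0 ≤ ∏ i ∈ W, (1 - a i) := Finset.prod_nonneg fun i _ => by linarith [ha1 i]
  calc 1 / 16 * (1 - n * r l * t / 2) ≤ 1 / 16 * ∏ i ∈ W, (1 - a i) := by gcongr
    _ ≤ _ := by gcongr

end Families

/-! ### Mean explosion times -/

section Tail

variable {α : ℝ}

lemma urnRate_mono (hα : 0 ≤ α) : Monotone (urnRate α) := fun a b h => by
  unfold urnRate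
  gcongr

/-- The expected time that colour `0` with tally `k` takes to be selected infinitely often. -/
def urnTail (α : ℝ) (k : ℕ) : ℝ := ∑' j, 1 / urnRate α (k + j)

lemma summable_urnRate (hα : 1 < α) (k : ℕ) : Summable fun j => 1 / urnRate α (k + j) := by
  have h : Summable fun j => 1 / urnRate α j := by
    rw [← summable_nat_add_iff 1]
    have h1 := (summable_nat_add_iff 1).2 (Real.summable_one_div_nat_rpow.2 hα)
    refine h1.congr fun j => ?_
    rw [urnRate_of_one_le α (by omega)]
  have := (summable_nat_add_iff k).2 h
  exact this.congr fun j => by rw [add_comm]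

lemma urnTail_nonneg (α : ℝ) (k : ℕ) : 0 ≤ urnTail α k :=
  tsum_nonneg fun _ => one_div_nonneg.2 (urnRate_pos _ _).le

lemma sum_add_urnTail (hα : 1 < α) (d k : ℕ) :
    ∑ j ∈ Finset.range d, 1 / urnRate α (k + j) + urnTail α (k + d) = urnTail α k := by
  rw [urnTail, urnTail, ← (summable_urnRate hα k).sum_add_tsum_nat_add d]
  congr 1
  exact tsum_congr fun j => by rw [add_assoc, add_comm d j]

lemma tendsto_urnTail (α : ℝ) : Filter.Tendsto (urnTail α) Filter.atTop (nhds 0) := by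
  have := tendsto_sum_nat_add fun j => 1 / urnRate α j
  refine this.congr fun k => tsum_congr fun j => by rw [add_comm]

end Tail

/-! ### From harmonic functions to probabilities of the outcome -/

section Events

variable {α : ℝ} {m n : ℕ}

/-- The harmonic function is at most `1`, and it vanishes as soon as one colour has reached `l`. -/
lemma integral_notReached_le (hm : 1 ≤ m) (l : ℕ) {c : ℝ} (hc : 0 ≤ c) {L M : ℕ}
    (hM : m + M ≤ L) :
    ∫ t, (1 - reachFrom (urnRate α) l 1 (c + t)) ^ n ∂(passageLaw (urnRate α) (L - m) m) ≤
      uniformSeqLaw.real {u | ∀ i : Fin n, urnTally α m n u M i.succ < l} := by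
  have hr := urnRate_pos α
  have hB := backwardFamily_notReached hr l
  rw [← integral_spaceTimeMean hm hB hc hM]
  have hms : MeasurableSet {u | ∀ i : Fin n, urnTally α m n u M i.succ < l} :=
    measurable_urnTally M (Set.to_countable {x : Fin (n + 1) → ℕ | ∀ i : Fin n, x i.succ < l}).measurableSet
  rw [← integral_indicator_one hms]
  refine integral_mono_of_nonneg
    (Filter.Eventually.of_forall fun u => (hB.spaceTimeMean_mem hr hc L _).1)
    ((integrable_const _).indicator hms) (Filter.Eventually.of_forall fun u => ?_)
  by_cases hu : ∀ i : Fin n, urnTally α m n u M i.succ < l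
  · rw [Set.indicator_of_mem (by exact hu)]
    exact (hB.spaceTimeMean_mem hr hc L _).2
  · rw [Set.indicator_of_notMem (by exact hu)]
    push Not at hu
    obtain ⟨i, hi⟩ := hu
    refine le_of_eq ?_
    simp only [spaceTimeMean]
    rw [← integral_zero ℝ ℝ (μ := passageLaw (urnRate α) (L - urnTally α m n u M 0)
      (urnTally α m n u M 0))]
    congr 1
    ext t
    refine Finset.prod_eq_zero (Finset.mem_univ i) ?_
    rw [reachFrom_of_le hi, sub_self]

/-- The bound of `occupation_prod_ge` is affine in time, so only the mean of `c + t` matters, and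
this is `urnTail α (x 0)`. By `hx` the bracket then has mean at least `1 / 2`. -/
lemma le_occupation_spaceTimeMean (hα : 1 < α) {L : ℕ} {x : Fin (n + 1) → ℕ} (hL : x 0 ≤ L)
    (hcard : (Finset.univ.filter fun i : Fin n => x i.succ = m).card < 5)
    (hx : n * urnRate α m * urnTail α (x 0) ≤ 1) :
    1 / 32 ≤ spaceTimeMean (urnRate α) (fun k t => 1 - (reachFrom (urnRate α) m k t -
      reachFrom (urnRate α) (m + 1) k t) / 2) (urnTail α L) L x := by
  have hr := urnRate_pos α
  have hB := backwardFamily_occupation hr m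
  have := isProbabilityMeasure_passageLaw hr (L - x 0) (x 0)
  obtain ⟨i1, -, e1, -⟩ := passageLaw_moments hr (L - x 0) (x 0)
  have hT := sum_add_urnTail hα (L - x 0) (x 0)
  rw [← e1, Nat.add_sub_cancel' hL] at hT
  set c := urnTail α L
  have hc : 0 ≤ c := urnTail_nonneg α L
  set K : ℝ := n * urnRate α m with hK
  have i2 : Integrable (fun t => 1 / 16 * (1 - K * c / 2) - K / 32 * t)
      (passageLaw (urnRate α) (L - x 0) (x 0)) := (integrable_const _).sub (i1.const_mul _)
  calc (1 : ℝ) / 32 ≤ ∫ t, (1 / 16 * (1 - K * c / 2) - K / 32 * t)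
        ∂(passageLaw (urnRate α) (L - x 0) (x 0)) := by
        rw [integral_sub (integrable_const _) (i1.const_mul _), integral_const_mul (K / 32)]
        simp only [integral_const, probReal_univ, one_smul]
        rw [← hT] at hx
        nlinarith
    _ ≤ _ := by
        refine integral_mono_ae i2 (hB.integrable_prod hr hc (fun i => x i.succ) _ _ _)
          ((ae_nonneg_passageLaw hr _ _).mono fun t ht => ?_)
        have := occupation_prod_ge hr (urnRate_mono (by linarith)) (fun i : Fin n => x i.succ)
          hcard (add_nonneg hc ht)
        refine le_trans (le_of_eq ?_) this
        simp only [hK]; ring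

/-- The occupation functional bounds the probability that fewer than `5` colours have tally `m`
after `M` selections although colour `0` is already far ahead. -/
lemma measureReal_few_le (hm : 1 ≤ m) (hα : 1 < α) (L M : ℕ) (hM : m + M ≤ L) :
    uniformSeqLaw.real {u |
      (Finset.univ.filter fun i : Fin n => urnTally α m n u M i.succ = m).card < 5 ∧
      n * urnRate α m * urnTail α (urnTally α m n u M 0) ≤ 1} ≤
    32 * ∫ t, (1 - (reachFrom (urnRate α) m 1 (urnTail α L + t) -
      reachFrom (urnRate α) (m + 1) 1 (urnTail α L + t)) / 2) ^ n
        ∂(passageLaw (urnRate α) (L - m) m) := by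
  have hr := urnRate_pos α
  have hB := backwardFamily_occupation hr m
  have hc := urnTail_nonneg α L
  rw [← integral_spaceTimeMean hm hB hc hM, ← integral_const_mul]
  set A := {u | (Finset.univ.filter fun i : Fin n => urnTally α m n u M i.succ = m).card < 5 ∧
      n * urnRate α m * urnTail α (urnTally α m n u M 0) ≤ 1}
  have hms : MeasurableSet A := measurable_urnTally M (Set.to_countable {x : Fin (n + 1) → ℕ |
      (Finset.univ.filter fun i : Fin n => x i.succ = m).card < 5 ∧
      n * urnRate α m * urnTail α (x 0) ≤ 1}).measurableSet
  rw [← integral_indicator_one hms]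
  refine integral_mono_of_nonneg
    (Filter.Eventually.of_forall fun u => Set.indicator_nonneg (fun _ _ => zero_le_one) _) ?_
    (Filter.Eventually.of_forall fun u => ?_)
  · refine Integrable.of_bound (C := 32) ?_ (Filter.Eventually.of_forall fun u => ?_)
    · exact ((measurable_of_countable (fun x : Fin (n + 1) → ℕ =>
        32 * spaceTimeMean (urnRate α) _ _ L x)).comp (measurable_urnTally M)).aestronglyMeasurable
    · have := hB.spaceTimeMean_mem hr hc L (urnTally α m n u M)
      rw [Real.norm_of_nonneg (by linarith [this.1])]
      linarith [this.2]
  · by_cases hu : u ∈ A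
    · rw [Set.indicator_of_mem hu]
      have hL : urnTally α m n u M 0 ≤ L := by
        have := urnTally_le (α := α) (m := m) u M (0 : Fin (n + 1))
        simp only [urnTally, if_true] at this
        omega
      have := le_occupation_spaceTimeMean hα hL hu.1 hu.2
      simp only [Pi.one_apply]
      linarith
    · rw [Set.indicator_of_notMem hu]
      have := hB.spaceTimeMean_mem hr hc L (urnTally α m n u M)
      exact mul_nonneg (by norm_num) this.1

/-- Colours `i ≠ 0` start from `1`, so tally `m` means `m - 1` selections and tally `2 m` means `2 m
- 1`. Colour `0` starts from `m` and needs tally `3 m` for `2 m` selections. -/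
lemma urnOutcome_of_tally {u : ℕ → ℝ} {M : ℕ} (hm : 1 ≤ m)
    (h1 : ∀ i : Fin n, urnTally α m n u M i.succ < 2 * m + 1)
    (h2 : 5 ≤ (Finset.univ.filter fun i : Fin n => urnTally α m n u M i.succ = m).card)
    (h3 : 3 * m ≤ urnTally α m n u M 0) : UrnOutcome α m n u (Set.Iio M) := by
  refine ⟨fun i => ?_, ?_⟩
  · rw [urnCount_Iio]
    refine Fin.cases ?_ (fun i => ?_) i
    · simp only [urnTally, if_true, iff_true]
      exact_mod_cast (by omega : 2 * m - 1 < urnTally α m n u M 0 - m)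
    · have := h1 i
      simp only [urnTally, Fin.succ_ne_zero, if_false, iff_false, not_lt]
      exact_mod_cast (by omega : urnTally α m n u M i.succ - 1 ≤ 2 * m - 1)
  · calc (5 : ℕ∞) ≤ ((Finset.univ.filter fun i : Fin n =>
          urnTally α m n u M i.succ = m).card : ℕ∞) := by exact_mod_cast h2
      _ = Set.encard (Fin.succ '' {i : Fin n | urnTally α m n u M i.succ = m}) := by
          rw [(Fin.succ_injective n).encard_image, ← Set.encard_coe_eq_coe_finsetCard]
          simp
      _ ≤ _ := by
          refine Set.encard_le_encard ?_
          rintro _ ⟨i, hi, rfl⟩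
          rw [Set.mem_ofPred_eq] at hi ⊢
          rw [urnCount_Iio, hi]
          simp [urnTally]

lemma eventually_measureReal_outcome_ge (hm : 1 ≤ m) (hα : 1 < α) :
    ∃ M₀, ∀ M ≥ M₀,
      ∫ t, (1 - reachFrom (urnRate α) (2 * m + 1) 1 (urnTail α (m + M) + t)) ^ n
        ∂(passageLaw (urnRate α) M m) -
      32 * ∫ t, (1 - (reachFrom (urnRate α) m 1 (urnTail α (m + M) + t) -
        reachFrom (urnRate α) (m + 1) 1 (urnTail α (m + M) + t)) / 2) ^ n
        ∂(passageLaw (urnRate α) M m) ≤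
      uniformSeqLaw.real {u | UrnOutcome α m n u (Set.Iio M)} := by
  have hlim := (tendsto_urnTail α).const_mul (n * urnRate α m)
  rw [mul_zero] at hlim
  obtain ⟨M₁, hM₁⟩ := Filter.eventually_atTop.1 (hlim.eventually (ge_mem_nhds zero_lt_one))
  -- If the other colours stay at or below `2 m`, they hold at most `2 m n` of the total `m + n +
  -- M`. Colour `0` is then past both `M₁`, where its remaining time is negligible, and `3 m`.
  refine ⟨M₁ + 2 * m * n + 3 * m, fun M hM => ?_⟩
  have h1 := integral_notReached_le (α := α) (n := n) (M := M) hm (2 * m + 1)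
    (urnTail_nonneg α (m + M)) le_rfl
  have h2 := measureReal_few_le (n := n) hm hα (m + M) M le_rfl
  rw [Nat.add_sub_cancel_left] at h1 h2
  set A := {u | ∀ i : Fin n, urnTally α m n u M i.succ < 2 * m + 1}
  set B := {u | (Finset.univ.filter fun i : Fin n => urnTally α m n u M i.succ = m).card < 5 ∧
      n * urnRate α m * urnTail α (urnTally α m n u M 0) ≤ 1}
  have h3 : uniformSeqLaw.real A ≤
      uniformSeqLaw.real ({u | UrnOutcome α m n u (Set.Iio M)} ∪ B) := by
    refine ENNReal.toReal_mono (measure_ne_top _ _) (measure_mono_ae ?_)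
    filter_upwards [ae_mem_Ioc_uniformSeqLaw] with u hu hA
    have hs := sum_urnTally (α := α) (n := n) hm hu M
    rw [Fin.sum_univ_succ] at hs
    have h4 : ∑ i : Fin n, urnTally α m n u M i.succ ≤ ∑ _i : Fin n, 2 * m :=
      Finset.sum_le_sum fun i _ => Nat.lt_succ_iff.1 (hA i)
    simp only [Finset.sum_const, Finset.card_univ, Fintype.card_fin, smul_eq_mul] at h4
    have h5 : n * (2 * m) = 2 * m * n := by ring
    have h6 : M₁ + 3 * m ≤ urnTally α m n u M 0 := by omega
    by_cases hc : (Finset.univ.filter fun i : Fin n => urnTally α m n u M i.succ = m).card < 5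
    · exact Or.inr ⟨hc, hM₁ _ (by omega)⟩
    · exact Or.inl (urnOutcome_of_tally hm hA (not_lt.1 hc) (by omega))
  have h7 := h3.trans (measureReal_union_le _ _)
  linarith

/-- A uniform lower bound for finite stretches passes to the whole run. -/
lemma le_measureReal_outcome_univ {p : ℝ} {M₀ : ℕ}
    (h : ∀ M ≥ M₀, p ≤ uniformSeqLaw.real {u | UrnOutcome α m n u (Set.Iio M)}) :
    p ≤ uniformSeqLaw.real {u | UrnOutcome α m n u Set.univ} := by
  -- The intersection of the `A N` is the event that the outcome occurs at arbitrarily late times.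
  -- Continuity from above needs the measurability of the finite-stretch events.
  let A : ℕ → Set (ℕ → ℝ) := fun N => ⋃ M ≥ N, {u | UrnOutcome α m n u (Set.Iio M)}
  have hA : ∀ N, MeasurableSet (A N) := fun N =>
    MeasurableSet.iUnion fun M => MeasurableSet.iUnion fun _ => measurableSet_urnOutcome M
  have hanti : Antitone A := fun N N' hN => by
    intro u hu
    simp only [A, Set.mem_iUnion] at hu ⊢
    obtain ⟨M, hM, h⟩ := hu
    exact ⟨M, hN.trans hM, h⟩
  have hlim := tendsto_measure_iInter_atTop (μ := uniformSeqLaw)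
    (fun N => (hA N).nullMeasurableSet) hanti ⟨0, measure_ne_top _ _⟩
  have hlim' := (ENNReal.tendsto_toReal (measure_ne_top uniformSeqLaw (⋂ N, A N))).comp hlim
  have h1 : p ≤ uniformSeqLaw.real (⋂ N, A N) := by
    refine ge_of_tendsto hlim' (Filter.Eventually.of_forall fun N => ?_)
    refine (h (max M₀ N) (le_max_left _ _)).trans (measureReal_mono ?_ (measure_ne_top _ _))
    exact Set.subset_iUnion₂_of_subset (max M₀ N) (le_max_right _ _) subset_rfl
  refine h1.trans (measureReal_mono fun u hu => ?_)
  refine UrnOutcome.of_frequently fun N => ?_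
  have := Set.mem_iInter.1 hu N
  simp only [A, Set.mem_iUnion] at this
  obtain ⟨M, hM, h⟩ := this
  exact ⟨M, hM, h⟩

end Events

/-! ### Scaling and splitting of passage probabilities -/

section CdfBounds

variable {r : ℕ → ℝ}

lemma integrableOn_exp_mul {c : ℝ} (hc : 0 < c) (a : ℝ) {f : ℝ → ℝ} (hf : Measurable f)
    (h0 : ∀ s, 0 ≤ f s) (h1 : ∀ s, f s ≤ 1) :
    IntegrableOn (fun s => a * Real.exp (-(c * s)) * f s) (Set.Ioi 0) := by
  have i1 : IntegrableOn (fun s => a * Real.exp (-(c * s))) (Set.Ioi 0) := by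
    simpa [neg_mul, IntegrableOn] using (exp_neg_integrableOn_Ioi 0 hc).const_mul a
  refine Integrable.mul_bdd (c := 1) i1 hf.aestronglyMeasurable
    (Filter.Eventually.of_forall fun s => ?_)
  rw [Real.norm_of_nonneg (h0 s)]
  exact h1 s

lemma passageCdf_succ_mul (hr : ∀ k, 0 < r k) (d k : ℕ) {c : ℝ} (hc : 0 < c) (t : ℝ) :
    passageCdf r (d + 1) k (c * t) =
      c * ∫ s in Set.Ioi 0, r k * Real.exp (-(r k * c * s)) *
        passageCdf r d (k + 1) (c * (t - s)) := by
  have h := integral_comp_mul_left_Ioi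
    (fun s => r k * Real.exp (-(r k * s)) * passageCdf r d (k + 1) (c * t - s)) 0 hc
  rw [mul_zero, ← passageCdf_succ hr, smul_eq_mul] at h
  rw [eq_inv_mul_iff_mul_eq₀ hc.ne'] at h
  rw [← h]
  simp only [mul_sub, mul_assoc]

/-- Rescaling time multiplies each of the `d` exponential densities by at most `c`. -/
lemma passageCdf_mul_le (hr : ∀ k, 0 < r k) (d k : ℕ) {c : ℝ} (hc : 1 ≤ c) (t : ℝ) :
    passageCdf r d k (c * t) ≤ c ^ d * passageCdf r d k t := by
  have hc0 : 0 < c := one_pos.trans_le hc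
  induction d generalizing k t with
  | zero =>
    rcases lt_or_ge t 0 with h | h
    · rw [passageCdf_of_neg hr _ _ (mul_neg_of_pos_of_neg hc0 h), passageCdf_of_neg hr _ _ h]
      simp
    · rw [passageCdf_zero h, passageCdf_zero (by positivity)]; simp
  | succ d ih =>
    rw [passageCdf_succ_mul hr d k hc0, pow_succ', mul_assoc]
    refine mul_le_mul_of_nonneg_left ?_ hc0.le
    rw [passageCdf_succ hr, ← integral_const_mul]
    refine integral_mono_of_nonneg (Filter.Eventually.of_forall fun s =>
      mul_nonneg (mul_nonneg (hr k).le (Real.exp_pos _).le) (passageCdf_nonneg _ _ _)) ?_ ?_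
    · exact (integrableOn_exp_mul (hr k) (r k)
        ((passageCdf_mono hr d (k + 1)).measurable.comp (by fun_prop))
        (fun _ => passageCdf_nonneg _ _ _) fun _ => passageCdf_le_one hr _ _ _).const_mul _
    · filter_upwards [ae_restrict_mem measurableSet_Ioi] with s hs
      have hs' : 0 < s := hs
      have h1 : r k * Real.exp (-(r k * c * s)) ≤ r k * Real.exp (-(r k * s)) := by
        refine mul_le_mul_of_nonneg_left (Real.exp_le_exp.2 ?_) (hr k).le
        have : r k * s * 1 ≤ r k * s * c := mul_le_mul_of_nonneg_left hc (by have := hr k; positivity)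
        linarith
      calc _ ≤ r k * Real.exp (-(r k * s)) * (c ^ d * passageCdf r d (k + 1) (t - s)) :=
            mul_le_mul h1 (ih _ _) (passageCdf_nonneg _ _ _)
              (mul_nonneg (hr k).le (Real.exp_pos _).le)
        _ = _ := by ring

/-- Only the first `a` waiting times are stretched. Each gains a factor `c` and loses `exp (-(c - 1)
* r j * s)`; their lengths `s` add up to at most `t`, so the total loss is governed by `R * t`. -/
lemma le_passageCdf_mul (hr : ∀ k, 0 < r k) (a b k : ℕ) {R : ℝ} (hR0 : 0 ≤ R)
    (hR : ∀ j < k + a, r j ≤ R) {c : ℝ} (hc : 1 ≤ c) (t : ℝ) :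
    c ^ a * Real.exp (-((c - 1) * R * t)) * passageCdf r (a + b) k t ≤
      passageCdf r (a + b) k (c * t) := by
  have hc0 : 0 < c := one_pos.trans_le hc
  induction a generalizing k t with
  | zero =>
    rcases lt_or_ge t 0 with h | h
    · rw [passageCdf_of_neg hr _ _ h, mul_zero]; exact passageCdf_nonneg _ _ _
    · rw [pow_zero, one_mul]
      have h1 : Real.exp (-((c - 1) * R * t)) ≤ 1 := by
        rw [Real.exp_le_one_iff]
        have : 0 ≤ (c - 1) * R * t := mul_nonneg (mul_nonneg (by linarith) hR0) h
        linarith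
      refine (mul_le_of_le_one_left (passageCdf_nonneg _ _ _) h1).trans
        (passageCdf_mono hr _ _ ?_)
      nlinarith
  | succ a ih =>
    rw [show a + 1 + b = (a + b) + 1 by ring, passageCdf_succ_mul hr _ k hc0, pow_succ', mul_assoc,
      mul_assoc]
    refine mul_le_mul_of_nonneg_left ?_ hc0.le
    rw [passageCdf_succ hr, ← mul_assoc, ← integral_const_mul]
    have hi : ∀ s, 0 ≤ c ^ a * Real.exp (-((c - 1) * R * t)) *
        (r k * Real.exp (-(r k * s)) * passageCdf r (a + b) (k + 1) (t - s)) := fun s =>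
      mul_nonneg (by positivity)
        (mul_nonneg (mul_nonneg (hr k).le (Real.exp_pos _).le) (passageCdf_nonneg _ _ _))
    refine integral_mono_of_nonneg (Filter.Eventually.of_forall hi) ?_ ?_
    · exact integrableOn_exp_mul (mul_pos (hr k) hc0) (r k)
        ((passageCdf_mono hr (a + b) (k + 1)).measurable.comp (by fun_prop))
        (fun _ => passageCdf_nonneg _ _ _) fun _ => passageCdf_le_one hr _ _ _
    · filter_upwards [ae_restrict_mem measurableSet_Ioi] with s hs
      have hs' : 0 < s := hs
      have h1 : Real.exp (-((c - 1) * R * t)) * Real.exp (-(r k * s)) ≤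
          Real.exp (-(r k * c * s)) * Real.exp (-((c - 1) * R * (t - s))) := by
        rw [← Real.exp_add, ← Real.exp_add, Real.exp_le_exp]
        have : 0 ≤ (R - r k) * ((c - 1) * s) := mul_nonneg (sub_nonneg.2 (hR k (by omega)))
          (mul_nonneg (by linarith) hs'.le)
        linarith
      have h2 := ih (k + 1) (fun j hj => hR j (by omega)) (t - s)
      have h3 := passageCdf_nonneg (r := r) (a + b) (k + 1) (t - s)
      have hrk := hr k
      calc _ = c ^ a * r k * passageCdf r (a + b) (k + 1) (t - s) *
            (Real.exp (-((c - 1) * R * t)) * Real.exp (-(r k * s))) := by ring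
        _ ≤ c ^ a * r k * passageCdf r (a + b) (k + 1) (t - s) *
            (Real.exp (-(r k * c * s)) * Real.exp (-((c - 1) * R * (t - s)))) := by gcongr
        _ = r k * Real.exp (-(r k * c * s)) * (c ^ a * Real.exp (-((c - 1) * R * (t - s))) *
            passageCdf r (a + b) (k + 1) (t - s)) := by ring
        _ ≤ _ := by gcongr

/-- A Chernoff bound for the lower tail of passage times. -/
lemma passageCdf_le_exp (hr : ∀ k, 0 < r k) (d k : ℕ) {θ : ℝ} (hθ : 0 < θ)
    (h : ∀ j < k + d, r j ≤ θ) (t : ℝ) :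
    passageCdf r d k t ≤ (1 / 2) ^ d * Real.exp (θ * t) := by
  induction d generalizing k t with
  | zero =>
    rcases lt_or_ge t 0 with ht | ht
    · rw [passageCdf_of_neg hr _ _ ht]; positivity
    · rw [passageCdf_zero ht, pow_zero, one_mul]
      exact Real.one_le_exp (by positivity)
  | succ d ih =>
    have hs : 0 < r k + θ := add_pos (hr k) hθ
    have hexp : ∫ s in Set.Ioi 0, Real.exp (-(r k + θ) * s) = 1 / (r k + θ) := by
      have := integral_exp_mul_Ioi (a := -(r k + θ)) (by linarith) 0
      rw [this, mul_zero, Real.exp_zero, neg_div_neg_eq]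
    rw [passageCdf_succ hr]
    calc _ ≤ ∫ s in Set.Ioi 0, (1 / 2) ^ d * Real.exp (θ * t) * r k *
          Real.exp (-(r k + θ) * s) := by
          refine integral_mono_of_nonneg (Filter.Eventually.of_forall fun s =>
            mul_nonneg (mul_nonneg (hr k).le (Real.exp_pos _).le) (passageCdf_nonneg _ _ _)) ?_
            (Filter.Eventually.of_forall fun s => ?_)
          · exact (exp_neg_integrableOn_Ioi 0 hs).const_mul _
          · have h1 := ih (k + 1) (fun j hj => h j (by omega)) (t - s)
            have hrk := hr k
            calc _ ≤ r k * Real.exp (-(r k * s)) * ((1 / 2) ^ d * Real.exp (θ * (t - s))) := by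
                  simp only; gcongr
              _ = (1 / 2) ^ d * r k * (Real.exp (-(r k * s)) * Real.exp (θ * (t - s))) := by ring
              _ = (1 / 2) ^ d * r k * (Real.exp (θ * t) * Real.exp (-(r k + θ) * s)) := by
                  rw [← Real.exp_add, ← Real.exp_add]; ring_nf
              _ = _ := by ring
      _ = (1 / 2) ^ d * Real.exp (θ * t) * (r k / (r k + θ)) := by
          rw [integral_const_mul, hexp]; ring
      -- The Laplace transform of a waiting time at `θ` is `r k / (r k + θ)`, at most `1 / 2`
      -- because `r k ≤ θ`.
      _ ≤ (1 / 2) ^ d * Real.exp (θ * t) * (1 / 2) := by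
          refine mul_le_mul_of_nonneg_left ?_ (by positivity)
          rw [div_le_div_iff₀ hs two_pos]
          linarith [h k (by omega)]
      _ = _ := by ring

lemma passageCdf_one (hr : ∀ k, 0 < r k) (k : ℕ) {t : ℝ} (ht : 0 ≤ t) :
    passageCdf r 1 k t = 1 - Real.exp (-(r k * t)) := by
  have := isProbabilityMeasure_expMeasure (hr k)
  rw [passageCdf, passageLaw_one hr, ← cdf_eq_real, cdf_expMeasure_eq (hr k), if_pos ht]

lemma integrable_passageCdf_sub (hr : ∀ k, 0 < r k) (d e k j : ℕ) (t : ℝ) :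
    Integrable (fun s => passageCdf r e j (t - s)) (passageLaw r d k) := by
  have := isProbabilityMeasure_passageLaw hr d k
  refine Integrable.of_bound (C := 1)
    ((passageCdf_mono hr e j).measurable.comp (by fun_prop)).aestronglyMeasurable
    (Filter.Eventually.of_forall fun s => ?_)
  rw [Real.norm_of_nonneg (passageCdf_nonneg _ _ _)]
  exact passageCdf_le_one hr _ _ _

lemma integrable_indicator_passageLaw (hr : ∀ k, 0 < r k) (d k : ℕ) (t : ℝ) :
    Integrable ((Set.Iic t).indicator (1 : ℝ → ℝ)) (passageLaw r d k) := by
  have := isProbabilityMeasure_passageLaw hr d k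
  exact (integrable_const _).indicator measurableSet_Iic

lemma passageCdf_eq_integral (d k : ℕ) (t : ℝ) :
    passageCdf r d k t = ∫ s, (Set.Iic t).indicator (1 : ℝ → ℝ) s ∂(passageLaw r d k) :=
  (integral_indicator_one measurableSet_Iic).symm

/-- To be at `k + d` at time `t`, it suffices to arrive within the last `δ` units of time and not to
leave for a time `δ`. -/
lemma le_passageCdf_sub (hr : ∀ k, 0 < r k) (d k : ℕ) (t : ℝ) {δ : ℝ} (hδ : 0 ≤ δ) :
    Real.exp (-(r (k + d) * δ)) * (passageCdf r d k t - passageCdf r d k (t - δ)) ≤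
      passageCdf r d k t - passageCdf r (d + 1) k t := by
  have i1 := integrable_indicator_passageLaw hr d k
  have i2 := integrable_passageCdf_sub hr d 1 k (k + d) t
  rw [passageCdf_add hr d 1 k t, passageCdf_eq_integral d k t, passageCdf_eq_integral d k (t - δ),
    ← integral_sub (i1 t) (i1 (t - δ)), ← integral_sub (i1 t) i2, ← integral_const_mul]
  refine integral_mono (((i1 t).sub (i1 (t - δ))).const_mul _) ((i1 t).sub i2) fun s => ?_
  simp only [Set.indicator_apply, Set.mem_Iic, Pi.one_apply]
  by_cases h1 : s ≤ t
  · rw [if_pos h1, passageCdf_one hr _ (by linarith)]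
    by_cases h2 : s ≤ t - δ
    · rw [if_pos h2]; simp [Real.exp_nonneg]
    · rw [if_neg h2, sub_zero, mul_one, sub_sub_cancel, Real.exp_le_exp]
      have := mul_le_mul_of_nonneg_left (by linarith : t - s ≤ δ) (hr (k + d)).le
      linarith
  · rw [if_neg h1, if_neg (by linarith), passageCdf_of_neg hr _ _ (by linarith)]
    simp

/-- Either the first leg is over by `t - y`, or it is over by `t` and the second leg takes at most
`y`. -/
lemma passageCdf_add_le_split (hr : ∀ k, 0 < r k) (d e k : ℕ) (t y : ℝ) :
    passageCdf r (d + e) k t ≤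
      passageCdf r d k (t - y) + passageCdf r e (k + d) y * passageCdf r d k t := by
  have i1 := integrable_indicator_passageLaw hr d k
  rw [passageCdf_add hr, passageCdf_eq_integral d k t, passageCdf_eq_integral d k (t - y),
    ← integral_const_mul, ← integral_add (i1 _) ((i1 _).const_mul _)]
  refine integral_mono (integrable_passageCdf_sub hr _ _ _ _ _)
    ((i1 _).add ((i1 _).const_mul _)) fun s => ?_
  have h0 := passageCdf_nonneg (r := r) e (k + d) y
  simp only [Set.indicator_apply, Set.mem_Iic, Pi.one_apply]
  by_cases h1 : s ≤ t - y
  · rw [if_pos h1]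
    refine (passageCdf_le_one hr _ _ _).trans ?_
    split_ifs <;> linarith
  · rw [if_neg h1]
    by_cases h2 : s ≤ t
    · rw [if_pos h2, mul_one, zero_add]
      exact passageCdf_mono hr _ _ (by linarith)
    · rw [if_neg h2, passageCdf_of_neg hr _ _ (by linarith)]
      simp

/-- The probability is positive at some late time, and `passageCdf_mul_le` brings this back to `t`.
-/
lemma passageCdf_pos (hr : ∀ k, 0 < r k) (d k : ℕ) {t : ℝ} (ht : 0 < t) :
    0 < passageCdf r d k t := by
  have := isProbabilityMeasure_passageLaw hr d k
  have h1 := (tendsto_cdf_atTop (passageLaw r d k)).eventually (lt_mem_nhds (zero_lt_one))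
  obtain ⟨s, hs, hst⟩ := (h1.and (Filter.eventually_ge_atTop t)).exists
  rw [cdf_eq_real] at hs
  change 0 < passageCdf r d k s at hs
  have h2 := passageCdf_mul_le hr d k (c := s / t) ((one_le_div ht).2 hst) t
  rw [div_mul_cancel₀ _ ht.ne'] at h2
  exact pos_of_mul_pos_right (hs.trans_le h2) (by have := ht.trans_le hst; positivity)

end CdfBounds

/-! ### The mean explosion time is of order `m ^ (1 - α)` -/

section TailBounds

variable {α : ℝ}

lemma urnTail_ge (hα : 1 < α) {m : ℕ} (hm : 1 ≤ m) :
    (2 : ℝ) ^ (-α) * (m : ℝ) ^ (1 - α) ≤ urnTail α m := by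
  have hm' : (0 : ℝ) < m := by exact_mod_cast hm
  rw [← sum_add_urnTail hα m m]
  refine le_trans ?_ (le_add_of_nonneg_right (urnTail_nonneg _ _))
  have h : ∀ j ∈ Finset.range m, ((2 * m : ℝ) ^ α)⁻¹ ≤ 1 / urnRate α (m + j) := by
    intro j hj
    rw [urnRate_of_one_le α (by omega), one_div]
    have : ((m + j : ℕ) : ℝ) ≤ 2 * m := by
      have := Finset.mem_range.1 hj
      exact_mod_cast (by omega : m + j ≤ 2 * m)
    have h1 : 0 < ((m + j : ℕ) : ℝ) := by exact_mod_cast (by omega : 0 < m + j)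
    gcongr
  have h2 := Finset.sum_le_sum h
  rw [Finset.sum_const, Finset.card_range, nsmul_eq_mul] at h2
  refine le_trans (le_of_eq ?_) h2
  rw [Real.mul_rpow two_pos.le hm'.le, mul_inv, Real.rpow_neg two_pos.le, sub_eq_add_neg,
    Real.rpow_add hm', Real.rpow_one, Real.rpow_neg hm'.le]
  ring

/-- The telescoping form of the integral comparison; `2 ^ α` pays for replacing `x` by `x + 1 ≤ 2
x`. -/
lemma one_div_rpow_le_sub (hα : 1 < α) {x : ℝ} (hx : 1 ≤ x) :
    1 / x ^ α ≤ 2 ^ α / (α - 1) * (x ^ (1 - α) - (x + 1) ^ (1 - α)) := by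
  have hx0 : 0 < x := by linarith
  have hy0 : 0 < x + 1 := by linarith
  have hβ : 0 < α - 1 := by linarith
  have h1 : 1 + (α - 1) / (x + 1) ≤ (x / (x + 1)) ^ (1 - α) := by
    rw [Real.rpow_def_of_pos (by positivity)]
    have h2 := Real.log_le_sub_one_of_pos (x := x / (x + 1)) (by positivity)
    have h3 : x / (x + 1) - 1 = -(1 / (x + 1)) := by field_simp; ring
    have h4 := Real.add_one_le_exp (Real.log (x / (x + 1)) * (1 - α))
    have h5 : (α - 1) * (1 / (x + 1)) ≤ (α - 1) * -Real.log (x / (x + 1)) :=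
      mul_le_mul_of_nonneg_left (by linarith) hβ.le
    have h6 : (α - 1) / (x + 1) = (α - 1) * (1 / (x + 1)) := by ring
    linarith
  have h7 : (α - 1) * (x + 1) ^ (-α) ≤ x ^ (1 - α) - (x + 1) ^ (1 - α) := by
    rw [Real.div_rpow hx0.le hy0.le, le_div_iff₀ (by positivity)] at h1
    have h8 : (x + 1) ^ (1 - α) = (x + 1) * (x + 1) ^ (-α) := by
      rw [sub_eq_add_neg, Real.rpow_add hy0, Real.rpow_one]
    have h9 : (1 + (α - 1) / (x + 1)) * (x + 1) ^ (1 - α) =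
        (x + 1) ^ (1 - α) + (α - 1) * (x + 1) ^ (-α) := by
      rw [h8]; field_simp
    linarith
  have h10 : 1 / x ^ α ≤ 2 ^ α * (x + 1) ^ (-α) := by
    rw [Real.rpow_neg hy0.le, ← div_eq_mul_inv, div_le_div_iff₀ (by positivity) (by positivity),
      one_mul, ← Real.mul_rpow two_pos.le hx0.le]
    exact Real.rpow_le_rpow hy0.le (by linarith) (by linarith)
  refine h10.trans ?_
  rw [div_mul_eq_mul_div, le_div_iff₀ hβ]
  have : 0 < (2 : ℝ) ^ α := by positivity
  nlinarith

lemma urnTail_le (hα : 1 < α) {m : ℕ} (hm : 1 ≤ m) :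
    urnTail α m ≤ 2 ^ α / (α - 1) * (m : ℝ) ^ (1 - α) := by
  have hβ : 0 < α - 1 := by linarith
  refine Real.tsum_le_of_sum_range_le (fun _ => one_div_nonneg.2 (urnRate_pos _ _).le) fun d => ?_
  have h : ∀ j, 1 / urnRate α (m + j) ≤ 2 ^ α / (α - 1) * ((m + j : ℕ) : ℝ) ^ (1 - α) -
      2 ^ α / (α - 1) * ((m + (j + 1) : ℕ) : ℝ) ^ (1 - α) := by
    intro j
    rw [urnRate_of_one_le α (by omega), ← mul_sub]
    have := one_div_rpow_le_sub hα (x := ((m + j : ℕ) : ℝ)) (by exact_mod_cast (by omega))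
    refine this.trans (le_of_eq ?_)
    push_cast
    ring_nf
  refine (Finset.sum_le_sum fun j _ => h j).trans ?_
  rw [Finset.sum_range_sub' (fun j => 2 ^ α / (α - 1) * ((m + j : ℕ) : ℝ) ^ (1 - α))]
  simp only [add_zero]
  exact sub_le_self _ (by positivity)

end TailBounds

/-! ### Being at `m` against having passed `2 m` -/

section Core

variable {α : ℝ}

lemma exp_half_le {c : ℝ} (h1 : 1 ≤ c) (h2 : c ≤ 2) : Real.exp ((c - 1) / 2) ≤ c := by
  have h := Real.one_sub_inv_le_log_of_pos (x := c) (by linarith)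
  rw [← Real.le_log_iff_exp_le (by linarith)]
  refine le_trans ?_ h
  have h3 : c⁻¹ * c = 1 := inv_mul_cancel₀ (by linarith)
  nlinarith

/-- `HasGrowth α γ m` says that the probability of reaching `m` from `1` grows by a factor
of at least `exp ((c - 1) * γ * m)` when the time is multiplied by `c`. -/
def HasGrowth (α γ : ℝ) (m : ℕ) : Prop :=
  ∀ c t : ℝ, 1 ≤ c → c ≤ 2 → 0 ≤ t → t ≤ 2 * urnTail α m →
    Real.exp ((c - 1) * γ * m) * passageCdf (urnRate α) (m - 1) 1 t ≤
      passageCdf (urnRate α) (m - 1) 1 (c * t)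

/-- Passage times to a high level are so unlikely to be short that allowing a slightly larger
time makes them exponentially more likely. -/
lemma exists_hasGrowth (hα : 1 < α) {C : ℝ} (hC : 1 ≤ C)
    (hT : ∀ m : ℕ, 1 ≤ m → urnTail α m ≤ C * (m : ℝ) ^ (1 - α)) :
    ∃ γ : ℝ, 0 < γ ∧ γ ≤ 1 / 16 ∧ ∀ᶠ m : ℕ in Filter.atTop, HasGrowth α γ m := by
  have hβ : 0 < α - 1 := by linarith
  -- Chosen so that the first `K ≈ ε m` levels are slow on the time scale of `t`, namely `K ^ α * t
  -- ≤ K / 8`. Stretching them gains `exp (K * (c - 1) / 2)` and loses only `exp ((c - 1) * K / 8)`.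
  set ε : ℝ := min (1 / 2) ((1 / (16 * C)) ^ (1 / (α - 1))) with hε
  have hε0 : 0 < ε := lt_min (by norm_num) (by positivity)
  have hε1 : ε ≤ 1 / 2 := min_le_left _ _
  have hεβ : ε ^ (α - 1) ≤ 1 / (16 * C) := by
    calc ε ^ (α - 1) ≤ ((1 / (16 * C)) ^ (1 / (α - 1))) ^ (α - 1) :=
          Real.rpow_le_rpow hε0.le (min_le_right _ _) hβ.le
      _ = 1 / (16 * C) := by
          rw [← Real.rpow_mul (by positivity), one_div_mul_cancel hβ.ne', Real.rpow_one]
  refine ⟨ε / 8, by positivity, by linarith, ?_⟩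
  filter_upwards [Filter.eventually_ge_atTop (⌈2 / ε⌉₊ + 2)] with m hm c t hc1 hc2 ht0 ht
  have hm2 : 2 ≤ m := by omega
  have hm0 : (0 : ℝ) < m := by exact_mod_cast (by omega : 0 < m)
  have hmε : 2 ≤ ε * m := by
    have h1 : 2 / ε ≤ m := (Nat.le_ceil _).trans (by exact_mod_cast (by omega))
    rw [div_le_iff₀ hε0] at h1
    linarith
  set K := ⌊ε * m⌋₊ with hK
  have hK1 : (K : ℝ) ≤ ε * m := Nat.floor_le (by positivity)
  have hK2 : ε * m / 2 ≤ K := by linarith [Nat.lt_floor_add_one (ε * m)]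
  have hK0 : (0 : ℝ) < K := by linarith
  have hKm : K ≤ m - 1 := by
    have h1 : (K : ℝ) ≤ m / 2 := by nlinarith
    have h2 : 2 * K ≤ m := by
      have : (2 : ℝ) * K ≤ m := by linarith
      exact_mod_cast this
    omega
  have hR : ∀ j < 1 + K, urnRate α j ≤ (K : ℝ) ^ α := by
    intro j hj
    have hK1' : 1 ≤ K := by exact_mod_cast hK0
    rw [← urnRate_of_one_le α hK1']
    exact urnRate_mono (by linarith) (by omega)
  have h := le_passageCdf_mul (urnRate_pos α) K (m - 1 - K) 1 (by positivity) hR hc1 t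
  rw [Nat.add_sub_cancel' hKm] at h
  refine le_trans (mul_le_mul_of_nonneg_right ?_ (passageCdf_nonneg _ _ _)) h
  have hKt : (K : ℝ) ^ α * t ≤ K / 8 := by
    have e1 : (K : ℝ) ^ α = K * (K : ℝ) ^ (α - 1) := by
      conv_rhs => rw [← Real.rpow_one_add' hK0.le (by linarith)]
      ring_nf
    have e2 : (K : ℝ) ^ (α - 1) ≤ 1 / (16 * C) * (m : ℝ) ^ (α - 1) := by
      calc (K : ℝ) ^ (α - 1) ≤ (ε * m) ^ (α - 1) := Real.rpow_le_rpow hK0.le hK1 hβ.le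
        _ = ε ^ (α - 1) * (m : ℝ) ^ (α - 1) := Real.mul_rpow hε0.le hm0.le
        _ ≤ _ := by gcongr
    have e3 : t ≤ 2 * (C * (m : ℝ) ^ (1 - α)) := ht.trans (by linarith [hT m (by omega)])
    have e4 : (m : ℝ) ^ (α - 1) * (m : ℝ) ^ (1 - α) = 1 := by
      rw [← Real.rpow_add hm0]; simp
    calc (K : ℝ) ^ α * t = K * ((K : ℝ) ^ (α - 1) * t) := by rw [e1]; ring
      _ ≤ K * ((1 / (16 * C) * (m : ℝ) ^ (α - 1)) * (2 * (C * (m : ℝ) ^ (1 - α)))) := by gcongr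
      _ = K / 8 * ((m : ℝ) ^ (α - 1) * (m : ℝ) ^ (1 - α)) := by field_simp; ring
      _ = K / 8 := by rw [e4, mul_one]
  calc Real.exp ((c - 1) * (ε / 8) * m) ≤ Real.exp (K * ((c - 1) / 2) + -((c - 1) * (K / 8))) := by
        rw [Real.exp_le_exp]
        have : 0 ≤ (c - 1) * (K - ε * m / 2) := mul_nonneg (by linarith) (by linarith)
        nlinarith
    _ = Real.exp ((c - 1) / 2) ^ K * Real.exp (-((c - 1) * (K / 8))) := by
        rw [Real.exp_add, Real.exp_nat_mul]
    _ ≤ c ^ K * Real.exp (-((c - 1) * (K : ℝ) ^ α * t)) := by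
        rw [mul_assoc (c - 1)]
        refine mul_le_mul (pow_le_pow_left₀ (Real.exp_pos _).le (exp_half_le hc1 hc2) K)
          (Real.exp_le_exp.2 (neg_le_neg (mul_le_mul_of_nonneg_left hKt (by linarith))))
          (Real.exp_pos _).le (by positivity)

lemma HasGrowth.exp_mul_le {γ : ℝ} {m : ℕ} (h : HasGrowth α γ m) (hγ : 0 ≤ γ) {s t a : ℝ}
    (hs : 0 < s) (hst : (1 + a) * s ≤ t) (ha : 0 ≤ a) (hts : t ≤ 2 * s)
    (hT : s ≤ 2 * urnTail α m) :
    passageCdf (urnRate α) (m - 1) 1 s ≤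
      Real.exp (-(a * γ * m)) * passageCdf (urnRate α) (m - 1) 1 t := by
  have hc : 1 + a ≤ t / s := (le_div_iff₀ hs).2 hst
  have h3 := h (t / s) s (by linarith) ((div_le_iff₀ hs).2 hts) hs.le hT
  rw [div_mul_cancel₀ _ hs.ne'] at h3
  rw [Real.exp_neg, ← div_eq_inv_mul, le_div_iff₀ (Real.exp_pos _), mul_comm]
  refine le_trans (mul_le_mul_of_nonneg_right ?_ (passageCdf_nonneg _ _ _)) h3
  rw [Real.exp_le_exp]
  gcongr
  linarith

/-- By growth, at least half of the probability of having reached `m` by `t` comes from arrivals in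
the last `η μ`. Staying at `m` that long has probability at least `exp (-(η * C * m))`. -/
lemma HasGrowth.occupation_ge {γ η C : ℝ} {m : ℕ} (h : HasGrowth α γ m) (hγ : 0 ≤ γ)
    (hm : 1 ≤ m) (hη0 : 0 < η) (hη1 : η ≤ 1 / 4) (hμ : 0 < urnTail α m)
    (hC : (m : ℝ) ^ α * urnTail α m ≤ C * m) (he : Real.exp (-(η * γ * m)) ≤ 1 / 2) {t : ℝ}
    (ht1 : (1 - η) * urnTail α m ≤ t) (ht2 : t ≤ (1 + η) * urnTail α m) :
    1 / 2 * Real.exp (-(η * C * m)) * passageCdf (urnRate α) (m - 1) 1 ((1 - η) * urnTail α m) ≤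
      reachFrom (urnRate α) m 1 t - reachFrom (urnRate α) (m + 1) 1 t := by
  have hr := urnRate_pos α
  set μ := urnTail α m
  have hημ : 0 < η * μ := mul_pos hη0 hμ
  have hημ' : η * μ ≤ 1 / 4 * μ := mul_le_mul_of_nonneg_right hη1 hμ.le
  rw [sub_mul, one_mul] at ht1
  rw [add_mul, one_mul] at ht2
  have ht0 : 0 ≤ t := by linarith
  have h1 := le_passageCdf_sub hr (m - 1) 1 t (δ := η * μ) hημ.le
  rw [show 1 + (m - 1) = m by omega, show m - 1 + 1 = m by omega, urnRate_of_one_le α hm] at h1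
  rw [reachFrom, reachFrom, reach_eq_passageCdf hr _ _ ht0, reach_eq_passageCdf hr _ _ ht0,
    Nat.add_sub_cancel]
  refine le_trans ?_ h1
  have hle : η * (t - η * μ) ≤ η * μ := mul_le_mul_of_nonneg_left (by linarith) hη0.le
  have h2 := h.exp_mul_le hγ (s := t - η * μ) (t := t) (a := η) (by linarith) (by linarith)
    hη0.le (by linarith) (by linarith)
  have h3 := h2.trans (mul_le_mul_of_nonneg_right he (passageCdf_nonneg _ _ _))
  have h4 : passageCdf (urnRate α) (m - 1) 1 ((1 - η) * μ) ≤
      passageCdf (urnRate α) (m - 1) 1 t := passageCdf_mono hr _ _ (by linarith)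
  have h5 : (m : ℝ) ^ α * (η * μ) ≤ η * C * m := by
    have := mul_le_mul_of_nonneg_left hC hη0.le
    linarith
  have h6 := passageCdf_nonneg (r := urnRate α) (m - 1) 1 ((1 - η) * μ)
  calc 1 / 2 * Real.exp (-(η * C * m)) * passageCdf (urnRate α) (m - 1) 1 ((1 - η) * μ) =
        Real.exp (-(η * C * m)) * (1 / 2 * passageCdf (urnRate α) (m - 1) 1 ((1 - η) * μ)) := by
        ring
    _ ≤ _ := mul_le_mul (Real.exp_le_exp.2 (neg_le_neg h5)) (by linarith) (by positivity)
        (Real.exp_pos _).le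

lemma passageCdf_window_le (hr : ∀ k, 0 < urnRate α k) {η μ : ℝ} (hη0 : 0 < η) (hη1 : η ≤ 1 / 4)
    (m : ℕ) :
    passageCdf (urnRate α) (m - 1) 1 ((1 + η) * μ) ≤
      Real.exp (4 * η * m) * passageCdf (urnRate α) (m - 1) 1 ((1 - η) * μ) := by
  have hd : 0 < 1 - η := by linarith
  have h1 := passageCdf_mul_le hr (m - 1) 1 (c := (1 + η) / (1 - η))
    (by rw [le_div_iff₀ hd]; linarith) ((1 - η) * μ)
  rw [← mul_assoc, div_mul_cancel₀ _ hd.ne'] at h1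
  refine h1.trans (mul_le_mul_of_nonneg_right ?_ (passageCdf_nonneg _ _ _))
  have h2 : (1 + η) / (1 - η) ≤ Real.exp (4 * η) := by
    refine le_trans ?_ (Real.add_one_le_exp _)
    rw [div_le_iff₀ hd]; nlinarith
  calc ((1 + η) / (1 - η)) ^ (m - 1) ≤ Real.exp (4 * η) ^ (m - 1) :=
        pow_le_pow_left₀ (div_nonneg (by linarith) hd.le) h2 _
    _ ≤ Real.exp (4 * η) ^ m := pow_le_pow_right₀ (Real.one_le_exp (by positivity)) (by omega)
    _ = _ := by rw [← Real.exp_nat_mul]; ring_nf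

/-- The Chernoff bound with `θ = (2 m) ^ α`, the largest rate on the way. The time is such that `θ`
times it is `m / 4`, and `log 2 - 1 / 4 > 1 / 3`. -/
lemma passageCdf_double_le (hα : 1 < α) {m : ℕ} (hm : 1 ≤ m) :
    passageCdf (urnRate α) (m + 1) m (2 ^ (-α) / 4 * (m : ℝ) ^ (1 - α)) ≤
      Real.exp (-(1 / 3 * m)) := by
  have hm0 : (0 : ℝ) < m := by exact_mod_cast hm
  have h1 := passageCdf_le_exp (urnRate_pos α) (m + 1) m (θ := (2 * m : ℝ) ^ α) (by positivity)
    (fun j hj => by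
      have : (2 * m : ℝ) ^ α = urnRate α (2 * m) := by
        rw [urnRate_of_one_le α (by omega)]; push_cast; rfl
      rw [this]
      exact urnRate_mono (by linarith) (by omega)) (2 ^ (-α) / 4 * (m : ℝ) ^ (1 - α))
  have h2 : (2 * m : ℝ) ^ α * (2 ^ (-α) / 4 * (m : ℝ) ^ (1 - α)) = m / 4 := by
    have e1 : (2 : ℝ) ^ α * 2 ^ (-α) = 1 := by rw [← Real.rpow_add two_pos]; simp
    have e2 : (m : ℝ) ^ α * (m : ℝ) ^ (1 - α) = m := by rw [← Real.rpow_add hm0]; simp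
    rw [Real.mul_rpow two_pos.le hm0.le]
    calc _ = ((2 : ℝ) ^ α * 2 ^ (-α)) * ((m : ℝ) ^ α * (m : ℝ) ^ (1 - α)) / 4 := by ring
      _ = _ := by rw [e1, e2, one_mul]
  rw [h2] at h1
  refine h1.trans ?_
  have h3 : ((1 : ℝ) / 2) ^ (m + 1) ≤ Real.exp (-(Real.log 2 * m)) := by
    rw [Real.exp_neg, mul_comm, Real.exp_nat_mul, Real.exp_log two_pos, ← inv_pow,
      ← one_div]
    exact pow_le_pow_of_le_one (by norm_num) (by norm_num) (by omega)
  calc _ ≤ Real.exp (-(Real.log 2 * m)) * Real.exp (m / 4) := by gcongr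
    _ ≤ _ := by
      rw [← Real.exp_add, Real.exp_le_exp]
      have := mul_le_mul_of_nonneg_right Real.log_two_gt_d9.le hm0.le
      linarith

/-- The two terms are the two ways to overshoot: reaching `m` too early, which growth makes
unlikely, or crossing from `m` to `2 m + 1` too fast. Both are measured against the probability of
reaching `m` by the start of the window. -/
lemma HasGrowth.overshoot_le {γ η b : ℝ} {m : ℕ} (h : HasGrowth α γ m) (hα : 1 < α)
    (hγ : 0 ≤ γ) (hm : 1 ≤ m) (hη0 : 0 < η) (hηb : η ≤ b / 4) (hb : b ≤ 1 / 8)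
    (hμ : 0 < urnTail α m) (hbμ : b * urnTail α m ≤ 2 ^ (-α) / 4 * (m : ℝ) ^ (1 - α)) :
    reachFrom (urnRate α) (2 * m + 1) 1 ((1 + η) * urnTail α m) ≤
      (Real.exp (-(b / 2 * γ * m)) + Real.exp (-(1 / 3 * m)) * Real.exp (4 * η * m)) *
        passageCdf (urnRate α) (m - 1) 1 ((1 - η) * urnTail α m) := by
  have hr := urnRate_pos α
  set μ := urnTail α m
  rw [reachFrom, reach_eq_passageCdf hr _ _ (by positivity),
    show 2 * m + 1 - 1 = (m - 1) + (m + 1) by omega]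
  refine (passageCdf_add_le_split hr (m - 1) (m + 1) 1 _
    (2 ^ (-α) / 4 * (m : ℝ) ^ (1 - α))).trans ?_
  rw [show 1 + (m - 1) = m by omega, add_mul (Real.exp _)]
  refine add_le_add ?_ ?_
  · have hd : 0 < 1 + η - b := by linarith
    refine (passageCdf_mono hr _ _ (?_ : (1 + η) * μ - 2 ^ (-α) / 4 * (m : ℝ) ^ (1 - α) ≤ (1 + η - b) * μ)).trans
      (h.exp_mul_le hγ (mul_pos hd hμ) ?_ (by linarith) ?_ ?_)
    · have : (1 + η - b) * μ = (1 + η) * μ - b * μ := sub_mul _ _ _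
      linarith
    · rw [← mul_assoc]
      refine mul_le_mul_of_nonneg_right ?_ hμ.le
      nlinarith
    · rw [← mul_assoc]
      exact mul_le_mul_of_nonneg_right (by linarith) hμ.le
    · exact mul_le_mul_of_nonneg_right (by linarith) hμ.le
  · rw [mul_assoc]
    exact mul_le_mul (passageCdf_double_le hα hm) (passageCdf_window_le hr hη0 (by linarith) m)
      (passageCdf_nonneg _ _ _) (Real.exp_pos _).le

/-- There is a window of fixed relative width around the mean explosion time of colour `0` in
which another colour is much more likely to be at `m` than it is to have passed `2 m`. -/
lemma exists_window (hα : 1 < α) : ∃ η : ℝ, 0 < η ∧ η ≤ 1 / 4 ∧ ∀ ε > 0,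
    ∀ᶠ m : ℕ in Filter.atTop, ∃ q : ℝ, 0 < q ∧
      (∀ t, (1 - η) * urnTail α m ≤ t → t ≤ (1 + η) * urnTail α m →
        q ≤ reachFrom (urnRate α) m 1 t - reachFrom (urnRate α) (m + 1) 1 t) ∧
      reachFrom (urnRate α) (2 * m + 1) 1 ((1 + η) * urnTail α m) ≤ ε * q := by
  have hβ : 0 < α - 1 := by linarith
  set C : ℝ := 2 ^ α / (α - 1) + 1 with hCdef
  have hC : 1 ≤ C := by
    have : (0 : ℝ) ≤ 2 ^ α / (α - 1) := by positivity
    linarith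
  have hT : ∀ m : ℕ, 1 ≤ m → urnTail α m ≤ C * (m : ℝ) ^ (1 - α) := fun m hm =>
    (urnTail_le hα hm).trans (mul_le_mul_of_nonneg_right (by linarith) (by positivity))
  obtain ⟨γ, hγ0, hγ1, hgrow⟩ := exists_hasGrowth hα hC hT
  set b : ℝ := 2 ^ (-α) / 4 with hb
  have hb0 : 0 < b := by positivity
  have hb1 : b ≤ 1 / 8 := by
    have : (2 : ℝ) ^ (-α) ≤ 2 ^ (-1 : ℝ) :=
      Real.rpow_le_rpow_of_exponent_le (by norm_num) (by linarith)
    rw [Real.rpow_neg_one] at this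
    rw [hb]; linarith
  set b' : ℝ := b / C with hb'
  have hb'0 : 0 < b' := by positivity
  have hb'1 : b' ≤ 1 / 8 := (div_le_self hb0.le hC).trans hb1
  -- With this width, `exp (-(η * C * m))`, lost by waiting at `m`, equals `exp (-(b' * γ / 4 *
  -- m))`: only half of the exponent `b' / 2 * γ * m` gained against early arrivals.
  set η : ℝ := b' * γ / (4 * C) with hη
  have hη0 : 0 < η := by positivity
  have hηC : η * C = b' * γ / 4 := by rw [hη]; field_simp
  have hη1 : η ≤ b' * γ / 4 := by rw [← hηC]; nlinarith
  have hη2 : η ≤ b' / 64 := by nlinarith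
  refine ⟨η, hη0, by linarith, fun ε hε => ?_⟩
  have hlim : Filter.Tendsto (fun m : ℕ => 2 * Real.exp (-(b' * γ / 4 * m)) +
      2 * Real.exp (-(1 / 6 * m))) Filter.atTop (nhds 0) := by
    have h : ∀ c : ℝ, 0 < c → Filter.Tendsto (fun m : ℕ => 2 * Real.exp (-(c * m)))
        Filter.atTop (nhds 0) := fun c hc => by
      have := (Real.tendsto_exp_neg_atTop_nhds_zero.comp
        ((tendsto_natCast_atTop_atTop (R := ℝ)).const_mul_atTop hc)).const_mul 2
      simpa using this
    simpa using (h (b' * γ / 4) (by positivity)).add (h (1 / 6) (by norm_num))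
  have hlim2 : Filter.Tendsto (fun m : ℕ => Real.exp (-(η * γ * m))) Filter.atTop (nhds 0) :=
    Real.tendsto_exp_neg_atTop_nhds_zero.comp
      ((tendsto_natCast_atTop_atTop (R := ℝ)).const_mul_atTop (by positivity))
  filter_upwards [hgrow, hlim.eventually (ge_mem_nhds hε),
    hlim2.eventually (ge_mem_nhds (by norm_num : (0 : ℝ) < 1 / 2)),
    Filter.eventually_ge_atTop 1] with m hgrow hm1 hm2 hm
  have hm0 : (0 : ℝ) < m := by exact_mod_cast hm
  have hμ : 0 < urnTail α m := lt_of_lt_of_le (by positivity) (urnTail_ge hα hm)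
  have hμC := hT m hm
  have hRτ : (m : ℝ) ^ α * (m : ℝ) ^ (1 - α) = m := by
    rw [← Real.rpow_add hm0]; simp
  have hRμ : (m : ℝ) ^ α * urnTail α m ≤ C * m := by
    calc (m : ℝ) ^ α * urnTail α m ≤ (m : ℝ) ^ α * (C * (m : ℝ) ^ (1 - α)) := by gcongr
      _ = C * ((m : ℝ) ^ α * (m : ℝ) ^ (1 - α)) := by ring
      _ = _ := by rw [hRτ]
  have hbμ : b' * urnTail α m ≤ 2 ^ (-α) / 4 * (m : ℝ) ^ (1 - α) := by
    calc b' * urnTail α m ≤ b' * (C * (m : ℝ) ^ (1 - α)) := by gcongr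
      _ = _ := by rw [hb', hb]; field_simp
  have hA0 : 0 < passageCdf (urnRate α) (m - 1) 1 ((1 - η) * urnTail α m) :=
    passageCdf_pos (urnRate_pos α) _ _ (mul_pos (by linarith) hμ)
  refine ⟨1 / 2 * Real.exp (-(η * C * m)) *
    passageCdf (urnRate α) (m - 1) 1 ((1 - η) * urnTail α m), by positivity,
    fun t ht1 ht2 => hgrow.occupation_ge hγ0.le hm hη0 (by linarith) hμ hRμ hm2 ht1 ht2, ?_⟩
  refine (hgrow.overshoot_le hα hγ0.le hm hη0 (by linarith) hb'1 hμ hbμ).trans ?_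
  have e1 : Real.exp (-(b' / 2 * γ * m)) =
      Real.exp (-(b' * γ / 4 * m)) * Real.exp (-(η * C * m)) := by
    rw [← Real.exp_add, hηC]; ring_nf
  have e2 : Real.exp (-(1 / 3 * m)) * Real.exp (4 * η * m) ≤
      Real.exp (-(1 / 6 * m)) * Real.exp (-(η * C * m)) := by
    rw [← Real.exp_add, ← Real.exp_add, Real.exp_le_exp, hηC]
    have h1 : b' * γ ≤ 1 / 8 * (1 / 16) := mul_le_mul hb'1 hγ1 hγ0.le (by norm_num)
    have h2 := mul_le_mul_of_nonneg_right (by linarith : 4 * η + b' * γ / 4 ≤ 1 / 6) hm0.le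
    linarith
  rw [← mul_assoc ε]
  refine mul_le_mul_of_nonneg_right ?_ hA0.le
  rw [e1]
  have h3 := mul_le_mul_of_nonneg_right hm1 (Real.exp_pos (-(η * C * m))).le
  linarith

end Core

/-! ### Choice of `n`, and passage to the theorem -/

section Parameters

variable {α : ℝ}

/-- Chebyshev's inequality for the explosion time of colour `0`. -/
lemma explosion_deviation (hα : 1 < α) {m : ℕ} (hm : 1 ≤ m) (M : ℕ) {η : ℝ} (hη : 0 < η) :
    (passageLaw (urnRate α) M m).real
      {t | η * urnTail α m ≤ |urnTail α (m + M) + t - urnTail α m|} ≤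
      2 ^ α / (η ^ 2 * m) := by
  have hr := urnRate_pos α
  have hm0 : (0 : ℝ) < m := by exact_mod_cast hm
  have hμ : 0 < urnTail α m := lt_of_lt_of_le (by positivity) (urnTail_ge hα hm)
  have h := passageLaw_deviation hr M m (mul_pos hη hμ)
  have hsum := sum_add_urnTail hα M m
  have e : ∀ t, urnTail α (m + M) + t - urnTail α m =
      t - ∑ j ∈ Finset.range M, 1 / urnRate α (m + j) := fun t => by rw [← hsum]; ring
  simp_rw [e]
  refine h.trans ?_
  have hv : ∑ j ∈ Finset.range M, (1 / urnRate α (m + j)) ^ 2 ≤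
      1 / urnRate α m * urnTail α m := by
    calc ∑ j ∈ Finset.range M, (1 / urnRate α (m + j)) ^ 2 ≤
          ∑ j ∈ Finset.range M, 1 / urnRate α m * (1 / urnRate α (m + j)) := by
          refine Finset.sum_le_sum fun j _ => ?_
          rw [sq]
          refine mul_le_mul_of_nonneg_right ?_ (one_div_nonneg.2 (hr _).le)
          exact one_div_le_one_div_of_le (hr _) (urnRate_mono (by linarith) (by omega))
      _ = 1 / urnRate α m * ∑ j ∈ Finset.range M, 1 / urnRate α (m + j) := by
          rw [Finset.mul_sum]
      _ ≤ _ := by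
          refine mul_le_mul_of_nonneg_left ?_ (one_div_nonneg.2 (hr _).le)
          linarith [urnTail_nonneg α (m + M)]
  -- The variance is at most `μ / urnRate α m`, so the relative variance is at most `1 / (urnRate α
  -- m * μ)`, which is of order `1 / m`.
  have hRμ : (m : ℝ) ≤ 2 ^ α * (urnRate α m * urnTail α m) := by
    rw [urnRate_of_one_le α hm]
    have h1 : (m : ℝ) ^ α * (m : ℝ) ^ (1 - α) = m := by rw [← Real.rpow_add hm0]; simp
    have h2 : (2 : ℝ) ^ α * 2 ^ (-α) = 1 := by rw [← Real.rpow_add two_pos]; simp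
    calc (m : ℝ) = 2 ^ α * 2 ^ (-α) * ((m : ℝ) ^ α * (m : ℝ) ^ (1 - α)) := by rw [h1, h2, one_mul]
      _ = 2 ^ α * ((m : ℝ) ^ α * (2 ^ (-α) * (m : ℝ) ^ (1 - α))) := by ring
      _ ≤ _ := by
          have := urnTail_ge hα hm
          gcongr
  have hrm := hr m
  rw [div_le_div_iff₀ (by positivity) (by positivity)]
  calc _ ≤ 1 / urnRate α m * urnTail α m * (η ^ 2 * m) := by gcongr
    _ ≤ 1 / urnRate α m * urnTail α m *
        (η ^ 2 * (2 ^ α * (urnRate α m * urnTail α m))) := by gcongr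
    _ = _ := by field_simp

lemma integral_window_ge {Ω : Type*} [MeasurableSpace Ω] (P : Measure Ω) [IsProbabilityMeasure P]
    {f : Ω → ℝ} {B : Set Ω} (hB : MeasurableSet B) {a v : ℝ} (ha : 0 ≤ a) (hi : Integrable f P)
    (h0 : ∀ᵐ ω ∂P, 0 ≤ f ω) (h1 : ∀ᵐ ω ∂P, ω ∉ B → a ≤ f ω) (hv : P.real B ≤ v) :
    a * (1 - v) ≤ ∫ ω, f ω ∂P := by
  calc a * (1 - v) ≤ a * P.real Bᶜ := by
        rw [probReal_compl_eq_one_sub hB]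
        gcongr
    _ = ∫ ω, Bᶜ.indicator (fun _ => a) ω ∂P := by
        rw [integral_indicator_const _ hB.compl, smul_eq_mul, mul_comm]
    _ ≤ _ := by
        refine integral_mono_ae ((integrable_const _).indicator hB.compl) hi ?_
        filter_upwards [h0, h1] with ω h0 h1
        by_cases hω : ω ∈ B
        · rw [Set.indicator_of_notMem (by simpa using hω)]; exact h0
        · rw [Set.indicator_of_mem (by simpa using hω)]; exact h1 hω

lemma integral_window_le {Ω : Type*} [MeasurableSpace Ω] (P : Measure Ω) [IsProbabilityMeasure P]
    {f : Ω → ℝ} {B : Set Ω} (hB : MeasurableSet B) {a v : ℝ} (ha : 0 ≤ a)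
    (h0 : ∀ᵐ ω ∂P, 0 ≤ f ω) (hf : ∀ᵐ ω ∂P, f ω ≤ 1)
    (h1 : ∀ᵐ ω ∂P, ω ∉ B → f ω ≤ a) (hv : P.real B ≤ v) :
    ∫ ω, f ω ∂P ≤ v + a := by
  have hi : Integrable (fun ω => B.indicator (fun _ => (1 : ℝ)) ω + a) P :=
    ((integrable_const _).indicator hB).add (integrable_const _)
  calc ∫ ω, f ω ∂P ≤ ∫ ω, (B.indicator (fun _ => (1 : ℝ)) ω + a) ∂P := by
        refine integral_mono_of_nonneg h0 hi ?_
        filter_upwards [hf, h1] with ω hf h1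
        by_cases hω : ω ∈ B
        · rw [Set.indicator_of_mem hω]; linarith
        · rw [Set.indicator_of_notMem hω, zero_add]; exact h1 hω
    _ = P.real B + a := by
        rw [integral_add ((integrable_const _).indicator hB) (integrable_const _),
          integral_indicator_const _ hB]
        simp
    _ ≤ _ := by linarith

lemma exists_urnParameters (hα : 1 < α) :
    ∃ m₀ : ℕ, ∀ m ≥ m₀, ∃ n ≥ 5, UrnParameters α m n := by
  obtain ⟨η, hη0, hη1, hwin⟩ := exists_window hα
  have hlim : Filter.Tendsto (fun m : ℕ => 2 ^ α / (η ^ 2 * (m : ℝ))) Filter.atTop (nhds 0) :=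
    Filter.Tendsto.div_atTop tendsto_const_nhds
      ((tendsto_natCast_atTop_atTop (R := ℝ)).const_mul_atTop (by positivity))
  rw [← Filter.eventually_atTop]
  -- Since `n * q ≤ 41` below, the ratio `1 / 4100` makes the expected number of overshooting
  -- colours at most `1 / 100`.
  filter_upwards [hwin (1 / 4100) (by norm_num),
    hlim.eventually (ge_mem_nhds (by norm_num : (0 : ℝ) < 1 / 1000)),
    Filter.eventually_ge_atTop 1] with m hq hv hm
  obtain ⟨q, hq0, hocc, hover⟩ := hq
  have hr := urnRate_pos α
  have hm0 : (0 : ℝ) < m := by exact_mod_cast hm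
  have hμ : 0 < urnTail α m := lt_of_lt_of_le (by positivity) (urnTail_ge hα hm)
  set μ := urnTail α m
  have hq1 : q ≤ 1 := by
    refine (hocc μ (by nlinarith) (by nlinarith)).trans ?_
    linarith [reachFrom_le_one hr m 1 hμ.le, reachFrom_nonneg hr (m + 1) 1 hμ.le]
  -- Makes `exp (-(n * q / 2))` at most `exp (-20)`, small enough to survive the factor `32`. In
  -- total the probability is at least `0.99 * 0.999 - 32 * 0.002 > 0.85`; a fixed value above `4 /
  -- 5` keeps the inequality strict in the limit.
  set n := ⌈40 / q⌉₊
  have hn1 : 40 / q ≤ n := Nat.le_ceil _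
  have hn2 : (n : ℝ) ≤ 40 / q + 1 := (Nat.ceil_lt_add_one (by positivity)).le
  have hnq : 40 ≤ n * q := (div_le_iff₀ hq0).1 hn1
  have hnq2 : n * q ≤ 41 := by
    have h1 := mul_le_mul_of_nonneg_right hn2 hq0.le
    rw [add_mul, div_mul_cancel₀ _ hq0.ne'] at h1
    linarith
  have hn5 : 5 ≤ n := by
    have h1 : (40 : ℝ) ≤ n := by
      have := mul_le_mul_of_nonneg_left hq1 (Nat.cast_nonneg (α := ℝ) n)
      linarith
    have h2 : 40 ≤ n := by exact_mod_cast h1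
    omega
  refine ⟨n, hn5, ?_⟩
  obtain ⟨M₀, hM₀⟩ := eventually_measureReal_outcome_ge (n := n) hm hα
  refine lt_of_lt_of_le (by norm_num : (4 : ℝ) / 5 < 85 / 100)
    (le_measureReal_outcome_univ (M₀ := M₀) fun M hM => le_trans ?_ (hM₀ M hM))
  have := isProbabilityMeasure_passageLaw hr M m
  set c := urnTail α (m + M)
  have hc : 0 ≤ c := urnTail_nonneg α _
  set B := {t | η * μ ≤ |c + t - μ|}
  have hBm : MeasurableSet B := measurableSet_le measurable_const (by fun_prop)
  have hBv : (passageLaw (urnRate α) M m).real B ≤ 1 / 1000 :=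
    (explosion_deviation hα hm M hη0).trans hv
  have hpos := ae_nonneg_passageLaw hr M m
  have hwindow : ∀ t ∉ B, (1 - η) * μ ≤ c + t ∧ c + t ≤ (1 + η) * μ := by
    intro t ht
    have h1 : |c + t - μ| < η * μ := not_le.1 ht
    rw [abs_lt] at h1
    constructor <;> linarith [h1.1, h1.2]
  have hF1 := backwardFamily_notReached hr (2 * m + 1)
  have hF2 := backwardFamily_occupation hr m
  have hQ := reachFrom_nonneg hr (2 * m + 1) 1 (by positivity : 0 ≤ (1 + η) * μ)
  have hnQ : n * reachFrom (urnRate α) (2 * m + 1) 1 ((1 + η) * μ) ≤ 1 / 100 := by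
    have := mul_le_mul_of_nonneg_left hover (Nat.cast_nonneg (α := ℝ) n)
    linarith
  have hI1 : 99 / 100 * (1 - 1 / 1000) ≤
      ∫ t, (1 - reachFrom (urnRate α) (2 * m + 1) 1 (c + t)) ^ n
        ∂(passageLaw (urnRate α) M m) := by
    refine integral_window_ge _ hBm (by norm_num) ?_ ?_ ?_ hBv
    · simpa using hF1.integrable_prod hr hc (fun _ : Fin n => 1) Finset.univ M m
    · exact hpos.mono fun t ht => pow_nonneg (hF1.nonneg 1 _ (add_nonneg hc ht)) n
    · filter_upwards [hpos] with t ht htB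
      have h1 : reachFrom (urnRate α) (2 * m + 1) 1 (c + t) ≤
          reachFrom (urnRate α) (2 * m + 1) 1 ((1 + η) * μ) := by
        rw [reachFrom, reachFrom, reach_eq_passageCdf hr _ _ (add_nonneg hc ht),
          reach_eq_passageCdf hr _ _ (by positivity)]
        exact passageCdf_mono hr _ _ (hwindow t htB).2
      have h2 := one_add_mul_le_pow (a := -reachFrom (urnRate α) (2 * m + 1) 1 (c + t))
        (by linarith [reachFrom_le_one hr (2 * m + 1) 1 (add_nonneg hc ht)]) n
      rw [← sub_eq_add_neg] at h2
      have h3 := mul_le_mul_of_nonneg_left h1 (Nat.cast_nonneg (α := ℝ) n)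
      linarith
  have hI2 : ∫ t, (1 - (reachFrom (urnRate α) m 1 (c + t) -
      reachFrom (urnRate α) (m + 1) 1 (c + t)) / 2) ^ n ∂(passageLaw (urnRate α) M m) ≤
        1 / 1000 + 1 / 1000 := by
    refine integral_window_le _ hBm (by norm_num) ?_ ?_ ?_ hBv
    · exact hpos.mono fun t ht => pow_nonneg (hF2.nonneg 1 _ (add_nonneg hc ht)) n
    · exact hpos.mono fun t ht => pow_le_one₀ (hF2.nonneg 1 _ (add_nonneg hc ht))
        (hF2.le_one 1 _ (add_nonneg hc ht))
    · filter_upwards [hpos] with t ht htB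
      have h1 := hocc _ (hwindow t htB).1 (hwindow t htB).2
      have h2 : 1 - (reachFrom (urnRate α) m 1 (c + t) -
          reachFrom (urnRate α) (m + 1) 1 (c + t)) / 2 ≤ Real.exp (-(q / 2)) := by
        linarith [Real.add_one_le_exp (-(q / 2))]
      calc _ ≤ Real.exp (-(q / 2)) ^ n :=
            pow_le_pow_left₀ (hF2.nonneg 1 _ (add_nonneg hc ht)) h2 n
        _ = Real.exp (-(n * q / 2)) := by rw [← Real.exp_nat_mul]; ring_nf
        _ ≤ Real.exp (-((20 : ℕ) * 1)) := Real.exp_le_exp.2 (by push_cast; linarith)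
        _ ≤ 1 / 1000 := by
          rw [Real.exp_neg, Real.exp_nat_mul, ← one_div]
          refine one_div_le_one_div_of_le (by norm_num) ?_
          calc (1000 : ℝ) ≤ 2 ^ 20 := by norm_num
            _ ≤ _ := by
              gcongr
              linarith [Real.add_one_le_exp (1 : ℝ)]
  linarith

/-- If the outcome of the whole run has probability more than `p`, so has that of every
sufficiently long finite stretch. -/
lemma exists_lt_measureReal_outcome {m n : ℕ} {p : ℝ}
    (h : p < uniformSeqLaw.real {u | UrnOutcome α m n u Set.univ}) :
    ∃ M₀, ∀ M ≥ M₀, p < uniformSeqLaw.real {u | UrnOutcome α m n u (Set.Iio M)} := by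
  -- These sets increase to a superset of the outcome of the whole run; continuity from below needs
  -- no measurability.
  let A : ℕ → Set (ℕ → ℝ) := fun N => {u | ∀ M ≥ N, UrnOutcome α m n u (Set.Iio M)}
  have hmono : Monotone A := fun N N' hN u hu M hM => hu M (hN.trans hM)
  have hlim := tendsto_measure_iUnion_atTop (μ := uniformSeqLaw) hmono
  have hlim' := (ENNReal.tendsto_toReal (measure_ne_top uniformSeqLaw (⋃ N, A N))).comp hlim
  have h1 : p < uniformSeqLaw.real (⋃ N, A N) := by
    refine h.trans_le (measureReal_mono (fun u hu => ?_) (measure_ne_top _ _))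
    obtain ⟨N, hN⟩ := UrnOutcome.eventually hu
    exact Set.mem_iUnion.2 ⟨N, hN⟩
  obtain ⟨M₀, hM₀⟩ := Filter.eventually_atTop.1 (hlim'.eventually (lt_mem_nhds h1))
  refine ⟨M₀, fun M hM => (hM₀ M₀ le_rfl).trans_le ?_⟩
  exact measureReal_mono (fun u hu => hu M hM) (measure_ne_top _ _)

lemma map_eq_uniformSeqLaw {Ω : Type*} [MeasurableSpace Ω] {P : Measure Ω}
    [IsProbabilityMeasure P] {U : ℕ → Ω → ℝ} (hU : ∀ j, Measurable (U j)) (hind : iIndepFun U P)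
    (hunif : ∀ j, pdf.IsUniform (U j) (Set.Icc 0 1) P) :
    P.map (fun ω j => U j ω) = uniformSeqLaw := by
  rw [hind.map_fun_eq_infinitePi_map hU, uniformSeqLaw]
  congr 1
  funext j
  have := hunif j
  rw [pdf.IsUniform] at this
  rw [this, ProbabilityTheory.cond]
  simp

end Parameters

end

theorem corollary1 (α : ℝ) (hα : 1 < α) :
    (∃ m₀ : ℕ, ∀ m ≥ m₀, ∃ n ≥ 5, UrnParameters α m n) ∧
    ∀ m n : ℕ, 1 ≤ m → 5 ≤ n → UrnParameters α m n →
      ∃ M₀ : ℕ, ∀ M ≥ M₀,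
        ∀ (Ω : Type*) [MeasurableSpace Ω] (P : Measure Ω) [IsProbabilityMeasure P]
          (U : ℕ → Ω → ℝ), (∀ j, Measurable (U j)) → iIndepFun U P →
          (∀ j, pdf.IsUniform (U j) (Set.Icc 0 1) P) →
          4 / 5 < P.real {ω | UrnOutcome α m n (fun j => U j ω) (Set.Iio M)} := by
  refine ⟨exists_urnParameters hα, fun m n _ _ h => ?_⟩
  obtain ⟨M₀, hM₀⟩ := exists_lt_measureReal_outcome h
  refine ⟨M₀, fun M hM Ω _ P _ U hU hind hunif => ?_⟩
  have h1 := hM₀ M hM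
  -- The threshold was found for the canonical law, so it serves every probability space.
  rw [← map_eq_uniformSeqLaw hU hind hunif,
    map_measureReal_apply (measurable_pi_lambda _ hU) (measurableSet_urnOutcome M)] at h1
  exact h1
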